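/- Fix a norm $\|\cdot\|$ on $\mathbb{R}^d$ and put $d(x,A)=\inf_{y\in A}\|x-y\|$. Let $\mathbb{F}\subset\mathbb{C}\subset[0,\infty)^d$ be closed cones containing $0$ (cone: $tx$ belongs to the set for every $x$ in it and every $t>0$), and let $\mathbb{O}=\mathbb{C}\setminus\mathbb{F}$. A set $B\subset\mathbb{O}$ is bounded away from $\mathbb{F}$ if $\inf_{x\in B}d(x,\mathbb{F})>0$. Let $\mathbb{M}^*(\mathbb{C},\mathbb{O})$ be the class of Borel measures on $\mathbb{O}$ that are finite on Borel sets bounded away from $\mathbb{F}$; $\mu_t\stackrel{*}{\to}\nu$ in $\mathbb{M}^*(\mathbb{C},\mathbb{O})$ means $\mu_t(B)\to\nu(B)$ for every Borel $B\subset\mathbb{O}$ bounded away from $\mathbb{F}$ with $\nu(\partial B)=0$, the boundary being relative to $\mathbb{O}$. Let $Z_1,Z_2,\dots$ be iid random vectors in $\mathbb{C}$ whose common distribution is regularly varying on $\mathbb{O}$: there are a nondecreasing function $b$ on $(0,\infty)$ with $b(t)\to\infty$ and a non-zero measure $\nu\in\mathbb{M}^*(\mathbb{C},\mathbb{O})$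 such that, as $t\to\infty$, $$t\,P[Z_1/b(t)\in\cdot\,]\stackrel{*}{\to}\nu(\cdot)\quad\text{in }\mathbb{M}^*(\mathbb{C},\mathbb{O}).$$ Let $\partial\aleph_{\mathbb{O}}=\{x\in\mathbb{O}:d(x,\mathbb{F})=1\}$, let the spectral measure be $$S_{\mathbb{O}}(\Lambda)=\frac{\nu\{x\in\mathbb{O}:d(x,\mathbb{F})\ge1,\ x/d(x,\mathbb{F})\in\Lambda\}}{\nu\{x\in\mathbb{O}:d(x,\mathbb{F})\ge1\}},\qquad \Lambda\subset\partial\aleph_{\mathbb{O}}\text{ Borel},$$ and let $P(\partial\aleph_{\mathbb{O}})$ be the space of Borel probability measures on $\partial\aleph_{\mathbb{O}}$ with the topology of weak convergence. Then $S_{\mathbb{O}}$ is a probability measure. Moreover, let $k=k_n$ be positive integers with $k_n\to\infty$ and $n/k_n\to\infty$, let $a$ be either the given normalizing function $b$ or the quantile function $t\mapsto F_d^{\leftarrow}(1-1/t)=\inf\{x:F_d(x)\ge1-1/t\}$, where $F_d$ is the distribution function of $d(Z_1,\mathbb{F})$, and put $d_i=d(Z_i,\mathbb{F})$ and $$S_n(\cdot)=\frac{\sum_{i=1}^n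 \mathbf 1\{d_i/a(n/k_n)>1,\ Z_i/d_i\in\cdot\,\}}{\sum_{i=1}^n\mathbf 1\{d_i/a(n/k_n)>1\}}.$$ Then the probability that the denominator vanishes tends to $0$, and, whatever fixed element of $P(\partial\aleph_{\mathbb{O}})$ is taken as the value of $S_n$ when it does vanish, $$S_n\Rightarrow S_{\mathbb{O}}\quad\text{in }P(\partial\aleph_{\mathbb{O}})\text{ as }n\to\infty,$$ that is, the random elements $S_n$ of $P(\partial\aleph_{\mathbb{O}})$ converge in distribution to the non-random element $S_{\mathbb{O}}$. -/

import Mathlib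

open MeasureTheory ProbabilityTheory Filter Set
open scoped Topology ENNReal

noncomputable section

namespace ConeRV

/-- A closed cone containing the origin: `t • x ∈ A` for all `x ∈ A` and `t > 0`. -/
structure IsClosedCone {d : ℕ} (A : Set (Fin d → ℝ)) : Prop where
  isClosed : IsClosed A
  zero_mem : (0 : Fin d → ℝ) ∈ A
  smul_mem : ∀ x ∈ A, ∀ t : ℝ, 0 < t → t • x ∈ A

/-- The distance `d(x, F) = inf_{y ∈ F} ‖x - y‖` for the norm `N` on `ℝ^d`. -/
def dst {d : ℕ} (N : Seminorm ℝ (Fin d → ℝ)) (F : Set (Fin d → ℝ)) (x : Fin d → ℝ) : ℝ :=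
  ⨅ y : F, N (x - y)

/-- A subset of `𝕆 = C \ F` is bounded away from `F` if it lies at a positive distance from `F`,
i.e. it is contained in `C \ F^r`, `F^r = {x ∈ C : d(x, F) < r}`, for some `r > 0`. -/
def BoundedAway {d : ℕ} (N : Seminorm ℝ (Fin d → ℝ)) (C F : Set (Fin d → ℝ))
    (B : Set ↥(C \ F)) : Prop :=
  ∃ r : ℝ, 0 < r ∧ ∀ x ∈ B, r ≤ dst N F x

/-- The class `𝕄*(C, 𝕆)`: Borel measures on `𝕆 = C \ F` that are finite on the Borel sets
bounded away from `F`. -/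
def MemMStar {d : ℕ} (N : Seminorm ℝ (Fin d → ℝ)) (C F : Set (Fin d → ℝ))
    (ν : Measure ↥(C \ F)) : Prop :=
  ∀ B : Set ↥(C \ F), MeasurableSet B → BoundedAway N C F B → ν B < ∞

/-- Convergence `μ_t → ν` in `𝕄*(C, 𝕆)` as `t → ∞`. The boundary of `B ⊆ 𝕆` is taken in the
space `𝕆`; for `B` bounded away from `F` it is also the boundary of `B` in `C`. -/
def TendstoMStar {d : ℕ} (N : Seminorm ℝ (Fin d → ℝ)) (C F : Set (Fin d → ℝ))
    (μ : ℝ → Measure ↥(C \ F)) (ν : Measure ↥(C \ F)) : Prop :=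
  ∀ B : Set ↥(C \ F), MeasurableSet B → BoundedAway N C F B → ν (frontier B) = 0 →
    Tendsto (fun t => μ t B) atTop (𝓝 (ν B))

/-- The measure `t P[Z / c ∈ ·]` on `𝕆 = C \ F`, where `μ` is the distribution of `Z`. -/
def scaledLaw {d : ℕ} (C F : Set (Fin d → ℝ)) (μ : Measure (Fin d → ℝ)) (t c : ℝ) :
    Measure ↥(C \ F) :=
  ENNReal.ofReal t • (μ.map (fun z => c⁻¹ • z)).comap Subtype.val

/-- The distribution `μ` is regularly varying on `𝕆 = C \ F` with normalizing function
`b(t) ↑ ∞` and non-zero limit measure `ν ∈ 𝕄*(C, 𝕆)`: `t P[Z / b(t) ∈ ·] → ν` in `𝕄*(C, 𝕆)`. -/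
structure IsRegularlyVarying {d : ℕ} (N : Seminorm ℝ (Fin d → ℝ)) (C F : Set (Fin d → ℝ))
    (μ : Measure (Fin d → ℝ)) (b : ℝ → ℝ) (ν : Measure ↥(C \ F)) : Prop where
  monotone : MonotoneOn b (Ioi 0)
  tendsto : Tendsto b atTop atTop
  ne_zero : ν ≠ 0
  mem : MemMStar N C F ν
  conv : TendstoMStar N C F (fun t => scaledLaw C F μ t (b t)) ν

/-- The unit sphere `∂ℵ = {x ∈ 𝕆 : d(x, F) = 1}`. -/
def unitSphere {d : ℕ} (N : Seminorm ℝ (Fin d → ℝ)) (C F : Set (Fin d → ℝ)) :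
    Set (Fin d → ℝ) :=
  {x | x ∈ C \ F ∧ dst N F x = 1}

/-- The spectral measure
`S(Λ) = ν {x : d(x, F) ≥ 1, x / d(x, F) ∈ Λ} / ν {x : d(x, F) ≥ 1}` on `∂ℵ`. -/
def spectralMeasure {d : ℕ} (N : Seminorm ℝ (Fin d → ℝ)) (C F : Set (Fin d → ℝ))
    (ν : Measure ↥(C \ F)) : Measure ↥(unitSphere N C F) :=
  (ν {x | 1 ≤ dst N F x})⁻¹ •
    ((ν.restrict {x | 1 ≤ dst N F x}).map
      (fun x : ↥(C \ F) => (dst N F x)⁻¹ • (x : Fin d → ℝ))).comap Subtype.val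

/-- The quantile function `F_d^←(1 - 1/t) = inf {x : F_d(x) ≥ 1 - 1/t}`, where `F_d` is the
distribution function of `d(Z, F)` and `μ` is the distribution of `Z`. -/
def distQuantile {d : ℕ} (N : Seminorm ℝ (Fin d → ℝ)) (F : Set (Fin d → ℝ))
    (μ : Measure (Fin d → ℝ)) (t : ℝ) : ℝ :=
  sInf {x : ℝ | 1 - 1 / t ≤ μ.real {z | dst N F z ≤ x}}

/-- The indices `i` among the first `n` with `d(z_i, F) / r > 1`. -/
def exceedances {d : ℕ} (N : Seminorm ℝ (Fin d → ℝ)) (F : Set (Fin d → ℝ)) (r : ℝ) (n : ℕ)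
    (z : ℕ → Fin d → ℝ) : Finset ℕ :=
  {i ∈ Finset.range n | 1 < dst N F (z i) / r}

/-- The empirical distribution on `∂ℵ` of the points `z_i / d(z_i, F)` over the indices `i`
among the first `n` with `d(z_i, F) / r > 1` (the zero measure if there is no such index). -/
def empiricalSpectral {d : ℕ} (N : Seminorm ℝ (Fin d → ℝ)) (C F : Set (Fin d → ℝ)) (r : ℝ)
    (n : ℕ) (z : ℕ → Fin d → ℝ) : Measure ↥(unitSphere N C F) :=
  ((exceedances N F r n z).card : ℝ≥0∞)⁻¹ •
    ∑ i ∈ exceedances N F r n z,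
      (Measure.dirac ((dst N F (z i))⁻¹ • z i)).comap Subtype.val

open Classical in
/-- The empirical spectral measure as an element of `P(∂ℵ)`. The ratio defining it is `0 / 0` when
there is no exceedance; in that case it is given the arbitrary value `Q`. -/
def empiricalSpectralPM {d : ℕ} (N : Seminorm ℝ (Fin d → ℝ)) (C F : Set (Fin d → ℝ))
    (Q : ProbabilityMeasure ↥(unitSphere N C F)) (r : ℝ) (n : ℕ) (z : ℕ → Fin d → ℝ) :
    ProbabilityMeasure ↥(unitSphere N C F) :=
  if h : IsProbabilityMeasure (empiricalSpectral N C F r n z) then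
    ⟨empiricalSpectral N C F r n z, h⟩ else Q

/-- Convergence in distribution of random elements `S_n` of `P(X)`, with its topology of weak
convergence and the corresponding Borel `σ`-algebra, to the non-random element `S`. -/
def TendstoInLaw {Ω X : Type*} [MeasurableSpace Ω] [TopologicalSpace X] [MeasurableSpace X]
    [OpensMeasurableSpace X] (P : Measure Ω) [IsProbabilityMeasure P]
    (Sn : ℕ → Ω → ProbabilityMeasure X) (S : ProbabilityMeasure X) : Prop :=
  letI : MeasurableSpace (ProbabilityMeasure X) := borel _
  haveI : OpensMeasurableSpace (ProbabilityMeasure X) := ⟨le_rfl⟩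
  TendstoInDistribution Sn atTop (fun _ : Ω => S) (fun _ => P) P

section Sanity

variable {d : ℕ} {N : Seminorm ℝ (Fin d → ℝ)} {C F : Set (Fin d → ℝ)}

theorem dst_nonneg (x : Fin d → ℝ) : 0 ≤ dst N F x :=
  Real.iInf_nonneg fun _ => apply_nonneg N _

/-- `d(·, F)` is homogeneous of order one. -/
theorem dst_smul (hF : IsClosedCone F) {t : ℝ} (ht : 0 < t) (x : Fin d → ℝ) :
    dst N F (t • x) = t * dst N F x := by
  unfold dst
  rw [Real.mul_iInf_of_nonneg ht.le]
  have key : ∀ y : F, t * N (x - y) = N (t • x - t • (y : Fin d → ℝ)) := fun y => by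
    rw [← smul_sub, map_smul_eq_mul, Real.norm_of_nonneg ht.le]
  simp_rw [key]
  let e : F ≃ F :=
    { toFun := fun y => ⟨t • (y : Fin d → ℝ), hF.smul_mem _ y.2 t ht⟩
      invFun := fun y => ⟨t⁻¹ • (y : Fin d → ℝ), hF.smul_mem _ y.2 _ (inv_pos.2 ht)⟩
      left_inv := fun y => Subtype.ext (by simp [smul_smul, ht.ne'])
      right_inv := fun y => Subtype.ext (by simp [smul_smul, ht.ne']) }
  exact (e.iInf_comp (g := fun y : F => N (t • x - y))).symm

theorem dst_eq_zero_of_mem {x : Fin d → ℝ} (hx : x ∈ F) : dst N F x = 0 := by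
  refine le_antisymm ?_ (dst_nonneg x)
  have h : dst N F x ≤ N (x - (⟨x, hx⟩ : F)) :=
    ciInf_le ⟨0, by rintro _ ⟨y, rfl⟩; exact apply_nonneg N _⟩ _
  simpa using h

/-- Points of `C` at positive distance from `F` are projected into `∂ℵ`. -/
theorem inv_dst_smul_mem (hC : IsClosedCone C) (hF : IsClosedCone F) {x : Fin d → ℝ}
    (hx : x ∈ C) (hd : 0 < dst N F x) : (dst N F x)⁻¹ • x ∈ unitSphere N C F := by
  have h1 : dst N F ((dst N F x)⁻¹ • x) = 1 := by
    rw [dst_smul hF (inv_pos.2 hd), inv_mul_cancel₀ hd.ne']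
  refine ⟨⟨hC.smul_mem _ hx _ (inv_pos.2 hd), fun h => ?_⟩, h1⟩
  rw [dst_eq_zero_of_mem h] at h1
  exact zero_ne_one h1

theorem continuous_dst (hF : IsClosedCone F) : Continuous (dst N F) := by
  haveI : Nonempty F := ⟨⟨0, hF.zero_mem⟩⟩
  have hN : Continuous N := by
    have h := N.convexOn.continuousOn isOpen_univ
    rwa [← continuousOn_univ]
  have hbdd : ∀ x, BddBelow (range fun y : F => N (x - y)) := fun x =>
    ⟨0, by rintro _ ⟨y, rfl⟩; exact apply_nonneg N _⟩
  have hle : ∀ x y, dst N F x ≤ N (x - y) + dst N F y := fun x y => by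
    unfold dst
    rw [← sub_le_iff_le_add']
    refine le_ciInf fun w => ?_
    rw [sub_le_iff_le_add']
    refine (ciInf_le (hbdd x) w).trans ?_
    have := map_add_le_add N (x - y) (y - w)
    simpa using this
  rw [continuous_iff_continuousAt]
  intro x
  rw [ContinuousAt, tendsto_iff_dist_tendsto_zero]
  have h0 : Tendsto (fun y => N (y - x)) (𝓝 x) (𝓝 0) := by
    have h : Continuous fun y => N (y - x) := hN.comp (continuous_id.sub continuous_const)
    simpa using h.tendsto x
  refine squeeze_zero (fun _ => dist_nonneg) (fun y => ?_) h0
  rw [Real.dist_eq, abs_le]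
  have h1 := hle y x
  have h2 := hle x y
  rw [map_sub_rev] at h2
  constructor <;> linarith

theorem measurableSet_unitSphere (hC : IsClosedCone C) (hF : IsClosedCone F) :
    MeasurableSet (unitSphere N C F) :=
  (hC.isClosed.measurableSet.diff hF.isClosed.measurableSet).inter
    ((continuous_dst hF).measurable (measurableSet_singleton 1))

/-- The empirical spectral measure is a probability measure on `∂ℵ` as soon as there is at least
one exceedance, so the default value in `empiricalSpectralPM` is used only without exceedances. -/
theorem isProbabilityMeasure_empiricalSpectral (hC : IsClosedCone C) (hF : IsClosedCone F)
    {r : ℝ} {n : ℕ} {z : ℕ → Fin d → ℝ} (hz : ∀ i, z i ∈ C)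
    (hne : (exceedances N F r n z).Nonempty) :
    IsProbabilityMeasure (empiricalSpectral N C F r n z) := by
  have h1 : ∀ i ∈ exceedances N F r n z,
      ((Measure.dirac ((dst N F (z i))⁻¹ • z i)).comap Subtype.val :
        Measure ↥(unitSphere N C F)) univ = 1 := by
    intro i hi
    have hi' : 1 < dst N F (z i) / r := (Finset.mem_filter.1 hi).2
    have hd : 0 < dst N F (z i) := by
      refine lt_of_le_of_ne (dst_nonneg _) fun h => ?_
      rw [← h, zero_div] at hi'
      exact absurd hi' (by norm_num)
    rw [comap_subtype_coe_apply (measurableSet_unitSphere hC hF), image_univ, Subtype.range_coe,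
      Measure.dirac_apply_of_mem (inv_dst_smul_mem hC hF (hz i) hd)]
  refine ⟨?_⟩
  rw [empiricalSpectral, Measure.smul_apply, Measure.finsetSum_apply, Finset.sum_congr rfl h1]
  simp only [Finset.sum_const, smul_eq_mul, nsmul_eq_mul, mul_one]
  exact ENNReal.inv_mul_cancel (by simpa using hne.ne_empty) (by simp)

end Sanity

end ConeRV

end

/-!
The spectral measure is a probability measure, and the empirical spectral measure is consistent.

*The limit measure.* Let `γ(x) = ν {d(·, F) > x}` and `G(x) = P[d(Z, F) > x]`, so that
`t G(b(t) x) → γ(x)` for all but countably many `x > 0`. Replacing `t` by `l t`, `l > 1`, and taking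
a limit `r` of `b(l t) / b(t)` along an ultrafilter gives `γ(r x) = γ(x) / l` for all `x > 0`
(`IsTailLimit.exists_scaling`). Iterating, `γ` vanishes nowhere; and since `γ` takes all
values between `0` and `γ(x)` beyond `x`, it has no jumps. Hence `0 < ν {d(·, F) ≥ 1} < ∞`, the
spectral measure is a probability measure, and the sphere `{d(·, F) = 1}` is not charged
(`IsRegularlyVarying.measure_dst_eq`).

*Mean measures.* Since the sphere is a null set, a continuity set of the spectral measure on `∂ℵ`
gives a continuity set of `ν` in `𝕆`, and the layer cake formula turns convergence on continuity
sets into `t E[f(Z / d) 1{d > b(t)}] → ∫_{d > 1} f(x / d) ν(dx)` for bounded continuous `f`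
on `∂ℵ`. The quantile function is handled without full homogeneity of `ν`: with
`κ = ν {d(·, F) > 1}`, the limit `t G(b(l t)) → κ / l` shows that `distQuantile` at `t` lies between
`b(l t)` and `b(l' t)` for all `l < κ < l'` and large `t`, so the same limit holds up to the
factor `1 / κ` (`IsRegularlyVarying.exists_tendsto_integral`).

*Law of large numbers.* By Chebyshev's inequality, the sums of `f(Z_i / d_i)` over the exceedances,
divided by `k_n`, converge in probability to `c ∫ f dS` with `c > 0`. The case `f = 1` shows that
there are exceedances with probability tending to `1`; the ratio of two such sums gives
`∫ f dS_n → ∫ f dS` in probability for each `f`, hence `S_n → S` in probability for the weak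
topology and so in law (`tendstoInLaw_of_tendsto_integral`).
-/

open scoped BoundedContinuousFunction

noncomputable section

namespace ConeRV

/-! ### Tail functions of regularly varying laws -/

/-- `γ` is the limit of the normalized tails `t G(b(t) x)`, outside a countable set of points `x`:
the one-dimensional shadow of regular variation. The last two fields hold for the tail
`γ(x) = ρ(x, ∞)` of any measure `ρ` on `(0, ∞)` which is finite away from `0`; right continuity is
recorded only in the direction in which it is not a consequence of monotonicity. -/
structure IsTailLimit (b G γ : ℝ → ℝ) (D : Set ℝ) : Prop where
  monotone : MonotoneOn b (Ioi 0)
  tendsto : Tendsto b atTop atTop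
  antitone : Antitone G
  countable : D.Countable
  conv : ∀ x, 0 < x → x ∉ D → Tendsto (fun t => t * G (b t * x)) atTop (𝓝 (γ x))
  exists_pos : ∃ x, 0 < x ∧ 0 < γ x
  limit_antitone : AntitoneOn γ (Ioi 0)
  exists_lt : ∀ ε, 0 < ε → ∃ x, 0 < x ∧ γ x < ε
  right_cont : ∀ x, 0 < x → ∀ v, v < γ x → ∃ y, x < y ∧ v < γ y

theorem exists_between_notMem {D : Set ℝ} (hD : D.Countable) {x y : ℝ} (h : x < y) :
    ∃ z, x < z ∧ z < y ∧ z ∉ D := by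
  obtain ⟨z, hz, h1, h2⟩ := (hD.dense_compl ℝ).exists_between h
  exact ⟨z, h1, h2, hz⟩

namespace IsTailLimit

variable {b G γ : ℝ → ℝ} {D : Set ℝ}

theorem conv_mul (h : IsTailLimit b G γ D) {l : ℝ} (hl : 0 < l) {x : ℝ} (hx : 0 < x)
    (hxD : x ∉ D) : Tendsto (fun t => t * G (b (l * t) * x)) atTop (𝓝 (γ x / l)) := by
  have h1 := ((h.conv x hx hxD).comp (tendsto_id.const_mul_atTop hl)).div_const l
  refine h1.congr fun t => ?_
  simp only [Function.comp, id]
  field_simp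

/-- Multiplying `t` by `l` amounts, in the limit, to multiplying `b` by a constant `r`. Here `r` is
the limit of `b (l t) / b t` along an ultrafilter; this ratio is bounded because `γ` is nonzero and
vanishes at infinity. -/
theorem exists_scaling (h : IsTailLimit b G γ D) {l : ℝ} (hl : 1 < l) :
    ∃ r, 1 ≤ r ∧ ∀ x, 0 < x → γ (r * x) = γ x / l := by
  have hl0 : 0 < l := by linarith
  have hbpos : ∀ᶠ t in atTop, 0 < b t := h.tendsto.eventually_gt_atTop 0
  have hlow : ∀ᶠ t in atTop, 1 ≤ b (l * t) / b t := by
    filter_upwards [hbpos, eventually_gt_atTop 0] with t ht ht0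
    rw [one_le_div ht]
    exact h.monotone ht0 (mul_pos hl0 ht0) (by nlinarith)
  obtain ⟨M, hM⟩ : ∃ M, ∀ᶠ t in atTop, b (l * t) / b t ≤ M := by
    obtain ⟨x₀, hx₀, hγ₀⟩ := h.exists_pos
    obtain ⟨x, hx, hxx, hxD⟩ := exists_between_notMem h.countable hx₀
    have hγx : 0 < γ x := hγ₀.trans_le (h.limit_antitone hx hx₀ hxx.le)
    obtain ⟨K, hK, hγK⟩ := h.exists_lt (γ x / l) (by positivity)
    obtain ⟨y, hy, -, hyD⟩ := exists_between_notMem h.countable (lt_add_one K)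
    have hy0 : 0 < y := hK.trans hy
    have hγy : γ y < γ x / l := (h.limit_antitone hK hy0 hy.le).trans_lt hγK
    refine ⟨y / x, ?_⟩
    filter_upwards [(h.conv y hy0 hyD).eventually_lt (h.conv_mul hl0 hx hxD) hγy, hbpos,
      eventually_gt_atTop 0] with t ht hb ht0
    rw [div_le_div_iff₀ hb hx]
    by_contra! hcon
    refine absurd ht (not_lt.2 (mul_le_mul_of_nonneg_left (h.antitone ?_) ht0.le))
    linarith
  let U : Ultrafilter ℝ := Ultrafilter.of atTop
  have hU : (U : Filter ℝ) ≤ atTop := Ultrafilter.of_le _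
  obtain ⟨r, hr, hlim⟩ := (isCompact_Icc (a := (1 : ℝ)) (b := M)).ultrafilter_le_nhds
    (U.map fun t => b (l * t) / b t) (by
      rw [le_principal_iff]
      exact hU (hlow.and hM))
  have hr0 : 0 < r := by linarith [hr.1]
  replace hlim : Tendsto (fun t => b (l * t) / b t) U (𝓝 r) := hlim
  have upper : ∀ x y, 0 < x → x < y → γ y / l ≤ γ (r * x) := by
    intro x y hx hxy
    obtain ⟨z, hxz, hzy, hzD⟩ := exists_between_notMem h.countable hxy
    have hz : 0 < z := hx.trans hxz
    obtain ⟨w, hw1, hw2, hwD⟩ :=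
      exists_between_notMem h.countable (mul_lt_mul_of_pos_left hxz hr0)
    have hw : 0 < w := (mul_pos hr0 hx).trans hw1
    have hzw : γ z / l ≤ γ w := by
      refine le_of_tendsto_of_tendsto ((h.conv_mul hl0 hz hzD).mono_left hU)
        ((h.conv w hw hwD).mono_left hU) ?_
      filter_upwards [hlim.eventually_const_lt ((div_lt_iff₀ hz).2 hw2), hU hbpos,
        hU (eventually_gt_atTop 0)] with t ht hb ht0
      rw [div_lt_div_iff₀ hz hb] at ht
      refine mul_le_mul_of_nonneg_left (h.antitone ?_) (le_of_lt ht0)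
      linarith
    calc γ y / l ≤ γ z / l := by
          gcongr
          exact h.limit_antitone hz (hz.trans hzy) hzy.le
      _ ≤ γ w := hzw
      _ ≤ γ (r * x) := h.limit_antitone (mul_pos hr0 hx) hw hw1.le
  have lower : ∀ x y, 0 < x → x < y → γ (r * y) ≤ γ x / l := by
    intro x y hx hxy
    obtain ⟨z, hxz, hzy, hzD⟩ := exists_between_notMem h.countable hxy
    have hz : 0 < z := hx.trans hxz
    obtain ⟨w, hw1, hw2, hwD⟩ :=
      exists_between_notMem h.countable (mul_lt_mul_of_pos_left hzy hr0)
    have hw : 0 < w := (mul_pos hr0 hz).trans hw1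
    have hzw : γ w ≤ γ z / l := by
      refine le_of_tendsto_of_tendsto ((h.conv w hw hwD).mono_left hU)
        ((h.conv_mul hl0 hz hzD).mono_left hU) ?_
      filter_upwards [hlim.eventually_lt_const ((lt_div_iff₀ hz).2 hw1), hU hbpos,
        hU (eventually_gt_atTop 0)] with t ht hb ht0
      rw [div_lt_div_iff₀ hb hz] at ht
      refine mul_le_mul_of_nonneg_left (h.antitone ?_) (le_of_lt ht0)
      linarith
    calc γ (r * y) ≤ γ w := h.limit_antitone hw (mul_pos hr0 (hx.trans hxy)) hw2.le
      _ ≤ γ z / l := hzw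
      _ ≤ γ x / l := by
          gcongr
          exact h.limit_antitone hx hz hxz.le
  refine ⟨r, hr.1, fun x hx => le_antisymm ?_ ?_⟩
  · refine le_of_forall_lt fun v hv => ?_
    obtain ⟨y, hy, hvy⟩ := h.right_cont _ (mul_pos hr0 hx) v hv
    have := lower x (y / r) hx (by rwa [lt_div_iff₀ hr0, mul_comm])
    rw [mul_div_cancel₀ _ hr0.ne'] at this
    exact hvy.trans_le this
  · refine le_of_forall_lt fun v hv => ?_
    obtain ⟨y, hy, hvy⟩ := h.right_cont x hx (v * l) (by rwa [lt_div_iff₀ hl0] at hv)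
    exact ((lt_div_iff₀ hl0).2 hvy).trans_le (upper x y hx hy)

theorem limit_pos (h : IsTailLimit b G γ D) {x : ℝ} (hx : 0 < x) : 0 < γ x := by
  obtain ⟨x₀, hx₀, hγ₀⟩ := h.exists_pos
  obtain ⟨r, hr1, hr⟩ := h.exists_scaling one_lt_two
  have hr0 : 0 < r := by linarith
  -- `r = 1` is impossible since `γ x₀ ≠ γ x₀ / 2`
  have hr1' : 1 < r := by
    refine lt_of_le_of_ne hr1 fun h1 => ?_
    have := hr x₀ hx₀
    rw [← h1, one_mul] at this
    linarith
  have hpow : ∀ n : ℕ, 0 < γ (r ^ n * x₀) := by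
    intro n
    induction n with
    | zero => simpa using hγ₀
    | succ n ih =>
      rw [pow_succ', mul_assoc, hr _ (by positivity)]
      positivity
  obtain ⟨n, hn⟩ := pow_unbounded_of_one_lt (x / x₀) hr1'
  exact (hpow n).trans_le (h.limit_antitone hx (mem_Ioi.2 (by positivity))
    ((div_lt_iff₀ hx₀).1 hn).le)

/-- `γ` has no jumps: by scaling it takes every value in `(0, γ (x / 2))`. -/
theorem exists_lt_of_lt (h : IsTailLimit b G γ D) {x v : ℝ} (hx : 0 < x) (hv : γ x < v) :
    ∃ y, 0 < y ∧ y < x ∧ γ y ≤ v := by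
  by_cases hv' : γ (x / 2) ≤ v
  · exact ⟨x / 2, by linarith, by linarith, hv'⟩
  have hv0 : 0 < v := (h.limit_pos hx).trans hv
  obtain ⟨r, hr1, hr⟩ := h.exists_scaling (l := γ (x / 2) / v)
    ((one_lt_div hv0).2 (not_le.1 hv'))
  have hγ := h.limit_pos (half_pos hx)
  have hval : γ (r * (x / 2)) = v := by
    rw [hr _ (by linarith)]
    field_simp
  have hpos : 0 < r * (x / 2) := by positivity
  refine ⟨r * (x / 2), hpos, ?_, hval.le⟩
  by_contra! hle
  have := h.limit_antitone hx hpos hle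
  linarith

end IsTailLimit

/-- If `a(t)` is squeezed between `b(l t)` for `l` on either side of `κ`, then tails normalized
by `a` have the limit of those normalized by `b`, divided by `κ`. -/
theorem tendsto_mul_of_squeeze {a b H : ℝ → ℝ} {κ m : ℝ} (hκ : 0 < κ) (hH : Antitone H)
    (hm : Tendsto (fun t => t * H (b t)) atTop (𝓝 m))
    (hlow : ∀ l, 0 < l → l < κ → ∀ᶠ t in atTop, b (l * t) ≤ a t)
    (hupp : ∀ l, κ < l → ∀ᶠ t in atTop, a t ≤ b (l * t)) :
    Tendsto (fun t => t * H (a t)) atTop (𝓝 (m / κ)) := by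
  have hmul : ∀ l, 0 < l → Tendsto (fun t => t * H (b (l * t))) atTop (𝓝 (m / l)) := by
    intro l hl
    refine ((hm.comp (tendsto_id.const_mul_atTop hl)).div_const l).congr fun t => ?_
    simp only [Function.comp, id]
    field_simp
  have hcont : Tendsto (fun l => m / l) (𝓝 κ) (𝓝 (m / κ)) :=
    tendsto_const_nhds.div tendsto_id hκ.ne'
  refine tendsto_order.2 ⟨fun v hv => ?_, fun v hv => ?_⟩
  · obtain ⟨l, hl, hl'⟩ : ∃ l, v < m / l ∧ κ < l :=
      (((hcont.eventually_const_lt hv).filter_mono nhdsWithin_le_nhds).and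
        (self_mem_nhdsWithin (s := Ioi κ))).exists
    filter_upwards [(hmul l (hκ.trans hl')).eventually_const_lt hl, hupp l hl',
      eventually_ge_atTop 0] with t h1 h2 h3
    exact h1.trans_le (mul_le_mul_of_nonneg_left (hH h2) h3)
  · obtain ⟨l, ⟨hl, hl0⟩, hl'⟩ : ∃ l, (m / l < v ∧ 0 < l) ∧ l < κ :=
      ((((hcont.eventually_lt_const hv).and (eventually_gt_nhds hκ)).filter_mono
        nhdsWithin_le_nhds).and (self_mem_nhdsWithin (s := Iio κ))).exists
    filter_upwards [(hmul l hl0).eventually_lt_const hl, hlow l hl0 hl',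
      eventually_ge_atTop 0] with t h1 h2 h3
    exact (mul_le_mul_of_nonneg_left (hH h2) h3).trans_lt h1

/-! ### Distance to the forbidden cone and projection onto the unit sphere -/

section Geometry

variable {d : ℕ} {N : Seminorm ℝ (Fin d → ℝ)} {C F : Set (Fin d → ℝ)}

/-- All norms on `ℝ^d` are equivalent; only the lower bound is needed. -/
theorem exists_pos_mul_norm_le (hN : ∀ x, N x = 0 → x = 0) :
    ∃ c, 0 < c ∧ ∀ x, c * ‖x‖ ≤ N x := by
  have hcont : Continuous N := by
    rw [← continuousOn_univ]
    exact N.convexOn.continuousOn isOpen_univ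
  rcases (Metric.sphere (0 : Fin d → ℝ) 1).eq_empty_or_nonempty with hE | hE
  · refine ⟨1, one_pos, fun x => ?_⟩
    by_cases hx : x = 0
    · simp [hx]
    · refine absurd (show (‖x‖⁻¹ • x) ∈ Metric.sphere (0 : Fin d → ℝ) 1 from ?_) (by simp [hE])
      simp [norm_smul, norm_ne_zero_iff.2 hx]
  · obtain ⟨u, hu, hmin⟩ := (isCompact_sphere (0 : Fin d → ℝ) 1).exists_isMinOn hE
      hcont.continuousOn
    have hu0 : u ≠ 0 := by
      rintro rfl
      simp at hu
    refine ⟨N u, lt_of_le_of_ne (apply_nonneg N u) fun h => hu0 (hN u h.symm), fun x => ?_⟩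
    by_cases hx : x = 0
    · simp [hx]
    have hx' : 0 < ‖x‖ := norm_pos_iff.2 hx
    have h1 : N u ≤ N (‖x‖⁻¹ • x) := hmin (by simp [norm_smul, hx'.ne'])
    rw [map_smul_eq_mul, norm_inv, norm_norm] at h1
    rwa [← le_div_iff₀ hx', div_eq_inv_mul]

theorem dst_pos (hN : ∀ x, N x = 0 → x = 0) (hF : IsClosedCone F) {x : Fin d → ℝ}
    (hx : x ∉ F) : 0 < dst N F x := by
  obtain ⟨c, hc, hcN⟩ := exists_pos_mul_norm_le hN
  have : Nonempty F := ⟨⟨0, hF.zero_mem⟩⟩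
  obtain ⟨ε, hε, hball⟩ := Metric.isOpen_iff.1 hF.isClosed.isOpen_compl x hx
  refine (mul_pos hc hε).trans_le (le_ciInf fun y => ?_)
  refine (mul_le_mul_of_nonneg_left ?_ hc.le).trans (hcN _)
  by_contra! h
  exact hball (by rwa [Metric.mem_ball, dist_comm, dist_eq_norm]) y.2

open Classical in
/-- The radial projection `x ↦ x / d(x, F)` onto `∂ℵ`, extended to all of `ℝ^d` by the constant
value `p` outside `{x ∈ C : d(x, F) > 0}`. -/
def radial (hC : IsClosedCone C) (hF : IsClosedCone F) (p : unitSphere N C F)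
    (x : Fin d → ℝ) : unitSphere N C F :=
  ⟨if x ∈ C ∧ 0 < dst N F x then (dst N F x)⁻¹ • x else p, by
    split_ifs with h
    · exact inv_dst_smul_mem hC hF h.1 h.2
    · exact p.2⟩

variable (hC : IsClosedCone C) (hF : IsClosedCone F) (p : unitSphere N C F)

theorem coe_radial {x : Fin d → ℝ} (hx : x ∈ C) (hd : 0 < dst N F x) :
    (radial hC hF p x : Fin d → ℝ) = (dst N F x)⁻¹ • x :=
  if_pos ⟨hx, hd⟩

theorem measurable_radial : Measurable (radial hC hF p) := by
  have hm : Measurable (dst N F) := (continuous_dst hF).measurable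
  refine Measurable.subtype_mk (Measurable.ite ?_ (hm.inv.smul measurable_id) measurable_const)
  exact hC.isClosed.measurableSet.inter (measurableSet_lt measurable_const hm)

theorem radial_smul {x : Fin d → ℝ} (hx : x ∈ C) (hd : 0 < dst N F x) {t : ℝ} (ht : 0 < t) :
    radial hC hF p (t • x) = radial hC hF p x := by
  have hdt : dst N F (t • x) = t * dst N F x := dst_smul hF ht x
  refine Subtype.ext ?_
  rw [coe_radial hC hF p hx hd, coe_radial hC hF p (hC.smul_mem x hx t ht)
    (by rw [hdt]; positivity), hdt, smul_smul, mul_inv, mul_assoc, mul_comm, mul_assoc,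
    mul_inv_cancel₀ ht.ne', mul_one]

theorem continuous_radial (hN : ∀ x, N x = 0 → x = 0) :
    Continuous fun x : ↥(C \ F) => radial hC hF p x := by
  refine Continuous.subtype_mk (f := fun x : ↥(C \ F) => (radial hC hF p x : Fin d → ℝ)) ?_ _
  have h : (fun x : ↥(C \ F) => (radial hC hF p x : Fin d → ℝ)) =
      fun x : ↥(C \ F) => (dst N F x)⁻¹ • (x : Fin d → ℝ) :=
    funext fun x => coe_radial hC hF p x.2.1 (dst_pos hN hF x.2.2)
  rw [h]
  exact (((continuous_dst hF).comp continuous_subtype_val).inv₀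
    fun x => (dst_pos hN hF x.2.2).ne').smul continuous_subtype_val

/-! ### Tails of a regularly varying law -/

/-- The set `{x ∈ 𝕆 : d(x, F) > r, x / d(x, F) ∈ Λ}`. -/
def polar (r : ℝ) (L : Set (unitSphere N C F)) : Set ↥(C \ F) :=
  {x | r < dst N F x ∧ radial hC hF p x ∈ L}

theorem measurable_dst_coe (hF : IsClosedCone F) : Measurable fun x : ↥(C \ F) => dst N F x :=
  (continuous_dst hF).measurable.comp measurable_subtype_coe

theorem measurableSet_polar (r : ℝ) {L : Set (unitSphere N C F)} (hL : MeasurableSet L) :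
    MeasurableSet (polar hC hF p r L) :=
  (measurableSet_lt measurable_const (measurable_dst_coe hF)).inter
    (((measurable_radial hC hF p).comp measurable_subtype_coe) hL)

theorem frontier_polar_subset (hN : ∀ x, N x = 0 → x = 0) (r : ℝ)
    (L : Set (unitSphere N C F)) :
    frontier (polar hC hF p r L) ⊆
      {x | dst N F x = r} ∪ polar hC hF p r (frontier L) := by
  have hd : Continuous fun x : ↥(C \ F) => dst N F x :=
    (continuous_dst hF).comp continuous_subtype_val
  have h : polar hC hF p r L =
    {x : ↥(C \ F) | r < dst N F x} ∩ (fun x : ↥(C \ F) => radial hC hF p x) ⁻¹' L := rfl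
  rw [h]
  refine (frontier_inter_subset _ _).trans (union_subset ?_ ?_)
  · exact fun x hx => Or.inl (frontier_lt_subset_eq continuous_const hd hx.1).symm
  · intro x hx
    have hle : r ≤ dst N F x := closure_lt_subset_le continuous_const hd hx.1
    rcases hle.eq_or_lt with hr | hr
    · exact Or.inl hr.symm
    · exact Or.inr ⟨hr, (continuous_radial hC hF p hN).frontier_preimage_subset L hx.2⟩

theorem scaledLaw_polar {μ : Measure (Fin d → ℝ)}
    (hμ : ∀ᵐ z ∂μ, z ∈ C) {c r : ℝ} (hc : 0 < c) (hr : 0 < r) (t : ℝ)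
    {L : Set (unitSphere N C F)} (hL : MeasurableSet L) :
    scaledLaw C F μ t c (polar hC hF p r L) =
      ENNReal.ofReal t * μ {z | c * r < dst N F z ∧ radial hC hF p z ∈ L} := by
  have hO : MeasurableSet (C \ F) := hC.isClosed.measurableSet.diff hF.isClosed.measurableSet
  rw [scaledLaw, Measure.smul_apply, smul_eq_mul, comap_subtype_coe_apply hO,
    Measure.map_apply (measurable_const_smul c⁻¹)
      (hO.subtype_image (measurableSet_polar hC hF p r hL))]
  congr 1
  refine measure_congr ?_
  filter_upwards [hμ] with z hz
  have hd : dst N F (c⁻¹ • z) = c⁻¹ * dst N F z := dst_smul hF (inv_pos.2 hc) z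
  have hlt : r < dst N F (c⁻¹ • z) ↔ c * r < dst N F z := by
    rw [hd, inv_mul_eq_div, lt_div_iff₀ hc, mul_comm]
  refine propext ⟨?_, ?_⟩
  · rintro ⟨x, ⟨hx1, hx2⟩, hx⟩
    replace hx : (x : Fin d → ℝ) = c⁻¹ • z := hx
    rw [hx] at hx1 hx2
    have hz1 := hlt.1 hx1
    rw [radial_smul hC hF p hz ((mul_pos hc hr).trans hz1) (inv_pos.2 hc)] at hx2
    exact ⟨hz1, hx2⟩
  · rintro ⟨hz1, hz2⟩
    have hz0 : 0 < dst N F (c⁻¹ • z) := hr.trans (hlt.2 hz1)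
    refine ⟨⟨c⁻¹ • z, hC.smul_mem z hz _ (inv_pos.2 hc), fun hzF => ?_⟩, ⟨hlt.2 hz1, ?_⟩, rfl⟩
    · exact hz0.ne' (dst_eq_zero_of_mem hzF)
    · change radial hC hF p (c⁻¹ • z) ∈ L
      rwa [radial_smul hC hF p hz ((mul_pos hc hr).trans hz1) (inv_pos.2 hc)]

end Geometry

section Limit

variable {d : ℕ} {N : Seminorm ℝ (Fin d → ℝ)} {C F : Set (Fin d → ℝ)}

/-- If a law is regularly varying on `𝕆` then `∂ℵ` is not empty. -/
theorem IsRegularlyVarying.nonempty_unitSphere (hN : ∀ x, N x = 0 → x = 0)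
    (hC : IsClosedCone C) (hF : IsClosedCone F)
    {μ : Measure (Fin d → ℝ)} {b : ℝ → ℝ} {ν : Measure ↥(C \ F)}
    (hRV : IsRegularlyVarying N C F μ b ν) : Nonempty (unitSphere N C F) := by
  have : Nonempty ↥(C \ F) := by
    by_contra h
    rw [not_nonempty_iff] at h
    exact hRV.ne_zero (Measure.eq_zero_of_isEmpty ν)
  obtain ⟨x⟩ := this
  exact ⟨⟨_, inv_dst_smul_mem hC hF x.2.1 (dst_pos hN hF x.2.2)⟩⟩

theorem MemMStar.measure_le_dst_lt_top (hF : IsClosedCone F) {ν : Measure ↥(C \ F)}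
    (hν : MemMStar N C F ν) {r : ℝ} (hr : 0 < r) : ν {x | r ≤ dst N F x} < ∞ :=
  hν _ (measurableSet_le measurable_const (measurable_dst_coe hF)) ⟨r, hr, fun _ hx => hx⟩

theorem MemMStar.measure_lt_dst_ne_top (hF : IsClosedCone F) {ν : Measure ↥(C \ F)}
    (hν : MemMStar N C F ν) {r : ℝ} (hr : 0 < r) : ν {x | r < dst N F x} ≠ ∞ :=
  ((measure_mono (s := {x : ↥(C \ F) | r < dst N F x}) (t := {x | r ≤ dst N F x})
    fun x (hx : r < dst N F x) => hx.le).trans_lt (hν.measure_le_dst_lt_top hF hr)).ne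

theorem MemMStar.antitoneOn_measureReal (hF : IsClosedCone F) {ν : Measure ↥(C \ F)}
    (hν : MemMStar N C F ν) : AntitoneOn (fun r => ν.real {x | r < dst N F x}) (Ioi 0) :=
  fun _ hr _ _ hrs => measureReal_mono (fun _ hx => lt_of_le_of_lt hrs hx)
    (hν.measure_lt_dst_ne_top hF hr)

theorem MemMStar.countable_atoms (hF : IsClosedCone F) {ν : Measure ↥(C \ F)}
    (hν : MemMStar N C F ν) : {r : ℝ | 0 < r ∧ ν {x | dst N F x = r} ≠ 0}.Countable := by
  have hsub : {r : ℝ | 0 < r ∧ ν {x | dst N F x = r} ≠ 0} ⊆ ⋃ n : ℕ,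
      {r : ℝ | 0 < ν.restrict {x | 1 / ((n : ℝ) + 1) ≤ dst N F x} {x | dst N F x = r}} := by
    rintro r ⟨hr, hνr⟩
    obtain ⟨n, hn⟩ := exists_nat_one_div_lt hr
    refine mem_iUnion.2 ⟨n, ?_⟩
    have hm : MeasurableSet {x : ↥(C \ F) | dst N F x = r} :=
      measurable_dst_coe hF (measurableSet_singleton r)
    rw [mem_ofPred_eq, Measure.restrict_apply hm, inter_eq_left.2, pos_iff_ne_zero]
    · exact hνr
    · intro x hx
      rw [mem_ofPred_eq, (show dst N F x = r from hx)]
      exact hn.le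
  refine (countable_iUnion fun n => ?_).mono hsub
  have : IsFiniteMeasure (ν.restrict {x | 1 / ((n : ℝ) + 1) ≤ dst N F x}) :=
    ⟨by simpa using hν.measure_le_dst_lt_top hF (r := 1 / ((n : ℝ) + 1)) (by positivity)⟩
  exact Measure.countable_meas_level_set_pos (measurable_dst_coe hF)

theorem MemMStar.exists_measureReal_lt (hF : IsClosedCone F) {ν : Measure ↥(C \ F)}
    (hν : MemMStar N C F ν) {ε : ℝ} (hε : 0 < ε) :
    ∃ r, 0 < r ∧ ν.real {x | r < dst N F x} < ε := by
  have hlim := tendsto_measure_iInter_atTop (μ := ν)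
    (s := fun n : ℕ => {x : ↥(C \ F) | (n : ℝ) < dst N F x})
    (fun n => (measurableSet_lt measurable_const (measurable_dst_coe hF)).nullMeasurableSet)
    (fun m n hmn x hx => lt_of_le_of_lt (Nat.cast_le.2 hmn : (m : ℝ) ≤ n) hx)
    ⟨1, by simpa using hν.measure_lt_dst_ne_top hF one_pos⟩
  have hempty : (⋂ n : ℕ, {x : ↥(C \ F) | (n : ℝ) < dst N F x}) = ∅ := by
    refine eq_empty_of_forall_notMem fun x hx => ?_
    obtain ⟨n, hn⟩ := exists_nat_ge (dst N F x)
    exact absurd (mem_iInter.1 hx n) (not_lt.2 hn)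
  rw [hempty, measure_empty] at hlim
  have hev := hlim.eventually_lt_const (ENNReal.ofReal_pos.2 hε)
  obtain ⟨n, hn, hn0⟩ := (hev.and (eventually_gt_atTop 0)).exists
  refine ⟨n, Nat.cast_pos.2 hn0, ?_⟩
  exact (ENNReal.toReal_lt_toReal hn.ne_top ENNReal.ofReal_ne_top).2 hn |>.trans_eq
    (ENNReal.toReal_ofReal hε.le)

theorem MemMStar.exists_lt_measureReal (hF : IsClosedCone F) {ν : Measure ↥(C \ F)}
    (hν : MemMStar N C F ν) {r v : ℝ} (hr : 0 < r) (hv : v < ν.real {x | r < dst N F x}) :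
    ∃ s, r < s ∧ v < ν.real {x | s < dst N F x} := by
  have hlim := tendsto_measure_iUnion_atTop (μ := ν)
    (s := fun n : ℕ => {x : ↥(C \ F) | r + 1 / ((n : ℝ) + 1) < dst N F x})
    (fun m n hmn x hx => lt_of_le_of_lt
      (add_le_add_right (one_div_le_one_div_of_le (by positivity) (by gcongr)) r) hx)
  have hU : (⋃ n : ℕ, {x : ↥(C \ F) | r + 1 / ((n : ℝ) + 1) < dst N F x}) =
      {x : ↥(C \ F) | r < dst N F x} := by
    refine Subset.antisymm (iUnion_subset fun n x hx => ?_) fun x hx => ?_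
    · have : 0 < 1 / ((n : ℝ) + 1) := by positivity
      exact (lt_add_of_pos_right r this).trans hx
    · obtain ⟨n, hn⟩ := exists_nat_one_div_lt (sub_pos.2 (show r < dst N F x from hx))
      exact mem_iUnion.2 ⟨n, by rw [mem_ofPred_eq]; linarith⟩
  rw [hU] at hlim
  have hlim' := (ENNReal.tendsto_toReal (hν.measure_lt_dst_ne_top hF hr)).comp hlim
  obtain ⟨n, hn⟩ := (hlim'.eventually_const_lt hv).exists
  exact ⟨r + 1 / ((n : ℝ) + 1), lt_add_of_pos_right r (by positivity), hn⟩

variable (hN : ∀ x, N x = 0 → x = 0) (hC : IsClosedCone C) (hF : IsClosedCone F)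
  {μ : Measure (Fin d → ℝ)} (hμ : ∀ᵐ z ∂μ, z ∈ C)
  {b : ℝ → ℝ} {ν : Measure ↥(C \ F)} (hRV : IsRegularlyVarying N C F μ b ν)

include hN hC hF hμ hRV

/-- Regular variation evaluated on a set of the form `polar r Λ`. -/
theorem IsRegularlyVarying.tendsto_polar (p : unitSphere N C F) {r : ℝ} (hr : 0 < r)
    (hνr : ν {x | dst N F x = r} = 0) {L : Set (unitSphere N C F)} (hL : MeasurableSet L)
    (hνL : ν (polar hC hF p r (frontier L)) = 0) :
    Tendsto (fun t => t * μ.real {z | b t * r < dst N F z ∧ radial hC hF p z ∈ L}) atTop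
      (𝓝 (ν.real (polar hC hF p r L))) := by
  have h := hRV.conv _ (measurableSet_polar hC hF p r hL) ⟨r, hr, fun x hx => hx.1.le⟩
    (measure_mono_null (frontier_polar_subset hC hF p hN r L) (measure_union_null hνr hνL))
  have hfin : ν (polar hC hF p r L) ≠ ∞ := ((measure_mono fun x hx => hx.1).trans_lt
    (hRV.mem.measure_lt_dst_ne_top hF hr).lt_top).ne
  refine ((ENNReal.tendsto_toReal hfin).comp h).congr' ?_
  filter_upwards [hRV.tendsto.eventually_gt_atTop 0, eventually_ge_atTop 0] with t hb ht
  simp only [Function.comp]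
  rw [scaledLaw_polar hC hF p hμ hb hr t hL, ENNReal.toReal_mul, ENNReal.toReal_ofReal ht]
  rfl

theorem IsRegularlyVarying.isTailLimit [IsProbabilityMeasure μ] :
    IsTailLimit b (fun r => μ.real {z | r < dst N F z}) (fun r => ν.real {x | r < dst N F x})
      {r : ℝ | 0 < r ∧ ν {x | dst N F x = r} ≠ 0} where
  monotone := hRV.monotone
  tendsto := hRV.tendsto
  antitone := fun r s hrs => measureReal_mono fun z hz => lt_of_le_of_lt hrs hz
  countable := hRV.mem.countable_atoms hF
  conv := by
    intro r hr hrD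
    obtain ⟨p⟩ := hRV.nonempty_unitSphere hN hC hF
    have hνr : ν {x | dst N F x = r} = 0 := by
      by_contra h
      exact hrD ⟨hr, h⟩
    simpa [polar] using hRV.tendsto_polar hN hC hF hμ p hr hνr MeasurableSet.univ
      (by simp [polar])
  exists_pos := by
    have hU : (⋃ n : ℕ, {x : ↥(C \ F) | 1 / ((n : ℝ) + 1) < dst N F x}) = univ := by
      refine eq_univ_of_forall fun x => ?_
      obtain ⟨n, hn⟩ := exists_nat_one_div_lt (dst_pos hN hF x.2.2)
      exact mem_iUnion.2 ⟨n, hn⟩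
    obtain ⟨n, hn⟩ : ∃ n : ℕ, ν {x : ↥(C \ F) | 1 / ((n : ℝ) + 1) < dst N F x} ≠ 0 := by
      by_contra! h
      refine hRV.ne_zero (Measure.measure_univ_eq_zero.1 ?_)
      rw [← hU]
      exact measure_iUnion_null h
    have hpos : 0 < 1 / ((n : ℝ) + 1) := by positivity
    exact ⟨_, hpos, ENNReal.toReal_pos hn (hRV.mem.measure_lt_dst_ne_top hF hpos)⟩
  limit_antitone := hRV.mem.antitoneOn_measureReal hF
  exists_lt := fun _ hε => hRV.mem.exists_measureReal_lt hF hε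
  right_cont := fun _ hr _ hv => hRV.mem.exists_lt_measureReal hF hr hv

theorem IsRegularlyVarying.measureReal_pos [IsProbabilityMeasure μ] {r : ℝ} (hr : 0 < r) :
    0 < ν.real {x | r < dst N F x} :=
  (hRV.isTailLimit hN hC hF hμ).limit_pos hr

/-- The limit measure does not charge the spheres `{x ∈ 𝕆 : d(x, F) = r}`. -/
theorem IsRegularlyVarying.measure_dst_eq [IsProbabilityMeasure μ] {r : ℝ} (hr : 0 < r) :
    ν {x | dst N F x = r} = 0 := by
  have hfin : ∀ s, 0 < s → ν {x | s < dst N F x} ≠ ∞ := fun s hs =>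
    hRV.mem.measure_lt_dst_ne_top hF hs
  have hfin' : ν {x | dst N F x = r} ≠ ∞ :=
    ((measure_mono (t := {x : ↥(C \ F) | r ≤ dst N F x}) fun x hx => ge_of_eq hx).trans_lt
      (hRV.mem.measure_le_dst_lt_top hF hr)).ne
  by_contra hne
  have hpos : 0 < ν.real {x | dst N F x = r} := ENNReal.toReal_pos hne hfin'
  obtain ⟨s, hs0, hs, hle⟩ := (hRV.isTailLimit hN hC hF hμ).exists_lt_of_lt (v :=
    ν.real {x | r < dst N F x} + ν.real {x | dst N F x = r} / 2) hr (by simpa using hpos)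
  have hunion : ν.real ({x | r < dst N F x} ∪ {x | dst N F x = r}) ≤
      ν.real {x | s < dst N F x} := by
    refine measureReal_mono (union_subset (fun x hx => hs.trans hx) fun x hx => ?_) (hfin s hs0)
    rw [mem_ofPred_eq, (show dst N F x = r from hx)]
    exact hs
  have hdisj : Disjoint {x : ↥(C \ F) | r < dst N F x} {x | dst N F x = r} :=
    disjoint_left.2 fun x hx hx' => (ne_of_gt hx) hx'
  rw [measureReal_union hdisj (measurable_dst_coe hF (measurableSet_singleton r)) (hfin r hr) hfin'] at hunion
  linarith

end Limit

/-! ### Weak convergence from convergence on continuity sets -/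

/-- Limits of integrals of bounded continuous functions need only be checked for nonnegative
functions, since `f = (f + ‖f‖) - ‖f‖`. -/
theorem tendsto_mul_integral_of_nonneg {ι X : Type*} [TopologicalSpace X]
    [MeasurableSpace X] [OpensMeasurableSpace X] {l : Filter ι}
    {μs : ι → Measure X} {μ : Measure X} [∀ i, IsFiniteMeasure (μs i)] [IsFiniteMeasure μ]
    {c : ι → ℝ} {k : ℝ}
    (h : ∀ g : X →ᵇ ℝ, (∀ x, 0 ≤ g x) →
      Tendsto (fun i => c i * ∫ x, g x ∂μs i) l (𝓝 (k * ∫ x, g x ∂μ))) (f : X →ᵇ ℝ) :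
    Tendsto (fun i => c i * ∫ x, f x ∂μs i) l (𝓝 (k * ∫ x, f x ∂μ)) := by
  let e : X →ᵇ ℝ := BoundedContinuousFunction.const X ‖f‖
  have h1 := h (f + e) fun x => by
    have := (abs_le.1 (f.norm_coe_le_norm x)).1
    have hx : (f + e) x = f x + ‖f‖ := rfl
    linarith
  have h2 := h e fun x => norm_nonneg f
  have h3 : ∀ (ρ : Measure X) [IsFiniteMeasure ρ],
      ∫ x, f x ∂ρ = ∫ x, (f + e) x ∂ρ - ∫ x, e x ∂ρ := by
    intro ρ _
    rw [← integral_sub ((f + e).integrable ρ) (e.integrable ρ)]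
    simp
  simp_rw [h3, mul_sub]
  exact h1.sub h2

/-- Finite measures, not necessarily of the same mass, which converge on all continuity sets of the
limit converge weakly: by the layer cake formula `∫ f` is an integral over `s` of the measures of
`{s ≤ f}`, and all but countably many of these sets are continuity sets. -/
theorem tendsto_integral_of_forall_null_frontier {ι X : Type*} [TopologicalSpace X]
    [MeasurableSpace X] [OpensMeasurableSpace X] {l : Filter ι} [l.IsCountablyGenerated]
    {μs : ι → Measure X} {μ : Measure X} [∀ i, IsFiniteMeasure (μs i)] [IsFiniteMeasure μ]
    (h : ∀ L, MeasurableSet L → μ (frontier L) = 0 →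
      Tendsto (fun i => (μs i).real L) l (𝓝 (μ.real L))) (f : X →ᵇ ℝ) :
    Tendsto (fun i => ∫ x, f x ∂μs i) l (𝓝 (∫ x, f x ∂μ)) := by
  have huniv := h univ MeasurableSet.univ (by simp)
  suffices hsuff : Tendsto (fun i => 1 * ∫ x, f x ∂μs i) l (𝓝 (1 * ∫ x, f x ∂μ)) by
    simpa only [one_mul] using hsuff
  refine tendsto_mul_integral_of_nonneg (fun g hg => ?_) f
  simp_rw [one_mul]
  have hlayer : ∀ (ρ : Measure X) [IsFiniteMeasure ρ],
      ∫ x, g x ∂ρ = ∫ s in Ioc 0 ‖g‖, ρ.real {x | s ≤ g x} := fun ρ _ =>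
    (g.integrable ρ).integral_eq_integral_Ioc_meas_le
      (Eventually.of_forall hg) (Eventually.of_forall fun x => g.apply_le_norm x)
  simp_rw [hlayer]
  have hgm : Measurable g := g.continuous.measurable
  refine tendsto_integral_filter_of_dominated_convergence (fun _ => μ.real univ + 1) ?_ ?_ ?_ ?_
  · refine Eventually.of_forall fun i => Measurable.aestronglyMeasurable ?_
    exact Antitone.measurable fun s t hst => measureReal_mono fun x hx => le_trans hst hx
  · filter_upwards [huniv.eventually_lt_const (lt_add_one _)] with i hi
    refine Eventually.of_forall fun s => ?_
    rw [Real.norm_of_nonneg measureReal_nonneg]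
    exact (measureReal_mono (subset_univ _)).trans hi.le
  · exact integrable_const _
  · have hnull : ∀ᵐ s : ℝ, μ {x | g x = s} = 0 := by
      have hc : {s : ℝ | 0 < μ {x | g x = s}}.Countable :=
        Measure.countable_meas_level_set_pos hgm
      filter_upwards [hc.ae_notMem volume] with s hs
      simpa using hs
    filter_upwards [ae_restrict_of_ae hnull] with s hs
    refine h _ (measurableSet_le measurable_const hgm) (measure_mono_null ?_ hs)
    exact fun x hx => (frontier_le_subset_eq continuous_const g.continuous hx).symm

/-! ### The quantile function as a generalized inverse of the tail -/

section

variable {d : ℕ} {N : Seminorm ℝ (Fin d → ℝ)} {F : Set (Fin d → ℝ)} {μ : Measure (Fin d → ℝ)}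
  [IsProbabilityMeasure μ]

theorem le_measureReal_dst_le_iff (hF : IsClosedCone F) {t : ℝ} (ht : 0 < t) (x : ℝ) :
    1 - 1 / t ≤ μ.real {z | dst N F z ≤ x} ↔ t * μ.real {z | x < dst N F z} ≤ 1 := by
  have hm : MeasurableSet {z | x < dst N F z} :=
    measurableSet_lt measurable_const (continuous_dst hF).measurable
  have hc : {z | dst N F z ≤ x} = {z | x < dst N F z}ᶜ := by
    ext z
    simp
  rw [hc, probReal_compl_eq_one_sub hm, sub_le_sub_iff_left, le_div_iff₀ ht, mul_comm]

theorem distQuantile_le (hF : IsClosedCone F) {t x : ℝ} (ht : 1 < t)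
    (hx : t * μ.real {z | x < dst N F z} ≤ 1) : distQuantile N F μ t ≤ x := by
  refine csInf_le ⟨0, fun y hy => ?_⟩ ((le_measureReal_dst_le_iff hF (one_pos.trans ht) x).2 hx)
  by_contra! hy0
  have hempty : {z | dst N F z ≤ y} = ∅ :=
    eq_empty_of_forall_notMem fun z hz => absurd (dst_nonneg z) (not_le.2 (lt_of_le_of_lt hz hy0))
  rw [mem_ofPred_eq, hempty, measureReal_empty, sub_nonpos, le_div_iff₀ (by linarith)] at hy
  linarith

theorem le_distQuantile (hF : IsClosedCone F) {t x y : ℝ} (ht : 0 < t)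
    (hx : 1 < t * μ.real {z | x < dst N F z}) (hy : t * μ.real {z | y < dst N F z} ≤ 1) :
    x ≤ distQuantile N F μ t := by
  refine le_csInf ⟨y, (le_measureReal_dst_le_iff hF ht y).2 hy⟩ fun w hw => ?_
  by_contra! hwx
  refine absurd ((le_measureReal_dst_le_iff hF ht w).1 hw) (not_le.2 (hx.trans_le ?_))
  exact mul_le_mul_of_nonneg_left
    (measureReal_mono fun z (hz : x < dst N F z) => hwx.trans hz) ht.le

end

/-! ### Exceedance measures and the spectral measure -/

section

variable {d : ℕ} {N : Seminorm ℝ (Fin d → ℝ)} {C F : Set (Fin d → ℝ)}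

/-- The measure `Λ ↦ P[d(Z, F) > r, Z / d(Z, F) ∈ Λ]` on `∂ℵ`, where `μ` is the law of `Z`. -/
def exceedanceMeasure (hC : IsClosedCone C) (hF : IsClosedCone F) (p : unitSphere N C F)
    (μ : Measure (Fin d → ℝ)) (r : ℝ) : Measure (unitSphere N C F) :=
  (μ.restrict {z | r < dst N F z}).map (radial hC hF p)

/-- The measure `Λ ↦ ν {x ∈ 𝕆 : d(x, F) > 1, x / d(x, F) ∈ Λ}` on `∂ℵ`, a multiple of the spectral
measure. -/
def radialLimit (hC : IsClosedCone C) (hF : IsClosedCone F) (p : unitSphere N C F)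
    (ν : Measure ↥(C \ F)) : Measure (unitSphere N C F) :=
  (ν.restrict {x | 1 < dst N F x}).map fun x : ↥(C \ F) => radial hC hF p x

variable (hN : ∀ x, N x = 0 → x = 0) (hC : IsClosedCone C) (hF : IsClosedCone F)
  (p : unitSphere N C F) {μ : Measure (Fin d → ℝ)} {ν : Measure ↥(C \ F)}

instance [IsFiniteMeasure μ] (r : ℝ) : IsFiniteMeasure (exceedanceMeasure hC hF p μ r) := by
  unfold exceedanceMeasure
  infer_instance

theorem exceedanceMeasure_apply (r : ℝ) {L : Set (unitSphere N C F)} (hL : MeasurableSet L) :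
    exceedanceMeasure hC hF p μ r L = μ {z | r < dst N F z ∧ radial hC hF p z ∈ L} := by
  have hm := measurable_radial hC hF p
  rw [exceedanceMeasure, Measure.map_apply hm hL, Measure.restrict_apply (hm hL), inter_comm]
  rfl

theorem integral_exceedanceMeasure (r : ℝ) (f : unitSphere N C F →ᵇ ℝ) :
    ∫ x, f x ∂exceedanceMeasure hC hF p μ r =
      ∫ z, {z | r < dst N F z}.indicator (fun z => f (radial hC hF p z)) z ∂μ := by
  rw [exceedanceMeasure, integral_map (measurable_radial hC hF p).aemeasurable
    f.continuous.aestronglyMeasurable, integral_indicator]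
  exact measurableSet_lt measurable_const (continuous_dst hF).measurable

theorem radialLimit_apply {L : Set (unitSphere N C F)} (hL : MeasurableSet L) :
    radialLimit hC hF p ν L = ν (polar hC hF p 1 L) := by
  have hm : Measurable fun x : ↥(C \ F) => radial hC hF p x :=
    (measurable_radial hC hF p).comp measurable_subtype_coe
  have h1 := Measure.map_apply (μ := ν.restrict {x | 1 < dst N F x}) hm hL
  rw [Measure.restrict_apply (hm hL), inter_comm] at h1
  exact h1

theorem MemMStar.isFiniteMeasure_radialLimit (hν : MemMStar N C F ν) :
    IsFiniteMeasure (radialLimit hC hF p ν) := by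
  refine ⟨?_⟩
  rw [radialLimit_apply hC hF p MeasurableSet.univ]
  simpa [polar] using (hν.measure_lt_dst_ne_top hF one_pos).lt_top

variable {b : ℝ → ℝ}

theorem ae_eq_one_le_dst (hν1 : ν {x | dst N F x = 1} = 0) :
    {x : ↥(C \ F) | 1 < dst N F x} =ᵐ[ν] {x : ↥(C \ F) | 1 ≤ dst N F x} := by
  have h : ∀ᵐ x : ↥(C \ F) ∂ν, dst N F x ≠ 1 := by simpa [ae_iff] using hν1
  filter_upwards [h] with x hx
  exact propext ⟨fun h => le_of_lt h, fun h => lt_of_le_of_ne h hx.symm⟩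

/-- In the definition of the spectral measure the condition `d(x, F) ≥ 1` can be replaced by
`d(x, F) > 1`. -/
theorem spectralMeasure_eq (hν1 : ν {x | dst N F x = 1} = 0) :
    spectralMeasure N C F ν =
      (ν {x | 1 < dst N F x})⁻¹ • radialLimit hC hF p ν := by
  have hae := ae_eq_one_le_dst hν1
  rw [spectralMeasure, ← measure_congr hae, ← Measure.restrict_congr_set hae]
  congr 1
  have hm : Measurable fun x : ↥(C \ F) => radial hC hF p x :=
    (measurable_radial hC hF p).comp measurable_subtype_coe
  have h1 : (ν.restrict {x | 1 < dst N F x}).map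
      (fun x : ↥(C \ F) => (dst N F x)⁻¹ • (x : Fin d → ℝ)) =
      (radialLimit hC hF p ν).map Subtype.val := by
    rw [radialLimit, Measure.map_map measurable_subtype_coe hm]
    refine Measure.map_congr ?_
    filter_upwards [ae_restrict_mem (measurableSet_lt measurable_const (measurable_dst_coe hF))]
      with x hx
    exact (coe_radial hC hF p x.2.1 (one_pos.trans hx)).symm
  rw [h1, (MeasurableEmbedding.subtype_coe (measurableSet_unitSphere hC hF)).comap_map]

variable [IsProbabilityMeasure μ] (hμ : ∀ᵐ z ∂μ, z ∈ C)
  (hRV : IsRegularlyVarying N C F μ b ν)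

include hN hC hF hμ hRV

theorem IsRegularlyVarying.isProbabilityMeasure_spectralMeasure :
    IsProbabilityMeasure (spectralMeasure N C F ν) := by
  obtain ⟨p⟩ := hRV.nonempty_unitSphere hN hC hF
  refine ⟨?_⟩
  rw [spectralMeasure_eq hC hF p (hRV.measure_dst_eq hN hC hF hμ one_pos), Measure.smul_apply,
    radialLimit_apply hC hF p MeasurableSet.univ, smul_eq_mul]
  have hpos := hRV.measureReal_pos hN hC hF hμ one_pos
  have hfin := hRV.mem.measure_lt_dst_ne_top hF one_pos
  simpa [polar] using ENNReal.inv_mul_cancel (fun h => by simp [measureReal_def, h] at hpos) hfin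

theorem IsRegularlyVarying.integral_radialLimit (f : unitSphere N C F →ᵇ ℝ) :
    ∫ x, f x ∂radialLimit hC hF p ν =
      ν.real {x | 1 < dst N F x} * ∫ x, f x ∂spectralMeasure N C F ν := by
  have hpos := hRV.measureReal_pos hN hC hF hμ one_pos
  rw [spectralMeasure_eq hC hF p (hRV.measure_dst_eq hN hC hF hμ one_pos),
    integral_smul_measure, ENNReal.toReal_inv, smul_eq_mul, ← measureReal_def, ← mul_assoc,
    mul_inv_cancel₀ hpos.ne', one_mul]

theorem IsRegularlyVarying.tendsto_integral_exceedanceMeasure (f : unitSphere N C F →ᵇ ℝ) :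
    Tendsto (fun t => t * ∫ x, f x ∂exceedanceMeasure hC hF p μ (b t)) atTop
      (𝓝 (∫ x, f x ∂radialLimit hC hF p ν)) := by
  have := hRV.mem.isFiniteMeasure_radialLimit hC hF p
  have hfin : ∀ t, IsFiniteMeasure
      (ENNReal.ofReal t • exceedanceMeasure hC hF p μ (b t)) := fun t =>
    Measure.smul_finite _ ENNReal.ofReal_ne_top
  have h := tendsto_integral_of_forall_null_frontier (l := atTop) (μ := radialLimit hC hF p ν)
    (μs := fun t => ENNReal.ofReal t • exceedanceMeasure hC hF p μ (b t)) ?_ f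
  · refine h.congr' ?_
    filter_upwards [eventually_ge_atTop 0] with t ht
    rw [integral_smul_measure, ENNReal.toReal_ofReal ht, smul_eq_mul]
  intro L hL hνL
  rw [radialLimit_apply hC hF p isClosed_frontier.measurableSet] at hνL
  have h := hRV.tendsto_polar hN hC hF hμ p one_pos
    (hRV.measure_dst_eq hN hC hF hμ one_pos) hL hνL
  rw [measureReal_def, ← radialLimit_apply hC hF p hL] at h
  refine h.congr' ?_
  filter_upwards [eventually_ge_atTop 0] with t ht
  rw [measureReal_ennreal_smul_apply, ENNReal.toReal_ofReal ht, measureReal_def, measureReal_def,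
    exceedanceMeasure_apply hC hF p _ hL, mul_one]

/-- A normalizing function `a` which is asymptotically `b(κ ·)` leads to the same limit, up to
the factor `κ`. -/
theorem IsRegularlyVarying.tendsto_integral_exceedanceMeasure_of_squeeze {a : ℝ → ℝ} {κ : ℝ}
    (hκ : 0 < κ) (hlow : ∀ l, 0 < l → l < κ → ∀ᶠ t in atTop, b (l * t) ≤ a t)
    (hupp : ∀ l, κ < l → ∀ᶠ t in atTop, a t ≤ b (l * t)) (f : unitSphere N C F →ᵇ ℝ) :
    Tendsto (fun t => t * ∫ x, f x ∂exceedanceMeasure hC hF p μ (a t)) atTop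
      (𝓝 ((∫ x, f x ∂radialLimit hC hF p ν) / κ)) := by
  have := hRV.mem.isFiniteMeasure_radialLimit hC hF p
  rw [div_eq_inv_mul]
  refine tendsto_mul_integral_of_nonneg (fun g hg => ?_) f
  rw [← div_eq_inv_mul]
  refine tendsto_mul_of_squeeze (H := fun r => ∫ x, g x ∂exceedanceMeasure hC hF p μ r) hκ ?_
    (hRV.tendsto_integral_exceedanceMeasure hN hC hF p hμ g) hlow hupp
  intro r s hrs
  refine integral_mono_measure ?_ (Eventually.of_forall hg) (g.integrable _)
  exact Measure.map_mono (Measure.restrict_mono_set _ fun z hz => lt_of_le_of_lt hrs hz)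
    (measurable_radial hC hF p)

omit p in
theorem IsRegularlyVarying.eventually_distQuantile_le {l : ℝ}
    (hl : ν.real {x | 1 < dst N F x} < l) :
    ∀ᶠ t in atTop, t * μ.real {z | b (l * t) < dst N F z} ≤ 1 ∧
      distQuantile N F μ t ≤ b (l * t) := by
  have hl0 : 0 < l := (hRV.measureReal_pos hN hC hF hμ one_pos).trans hl
  have h := (hRV.isTailLimit hN hC hF hμ).conv_mul hl0 one_pos
    (by simp [hRV.measure_dst_eq hN hC hF hμ one_pos])
  simp only [mul_one] at h
  filter_upwards [h.eventually_lt_const ((div_lt_one hl0).2 hl), eventually_gt_atTop 1]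
    with t ht ht1
  exact ⟨ht.le, distQuantile_le hF ht1 ht.le⟩

omit p in
theorem IsRegularlyVarying.eventually_le_distQuantile {l : ℝ} (hl0 : 0 < l)
    (hl : l < ν.real {x | 1 < dst N F x}) :
    ∀ᶠ t in atTop, b (l * t) ≤ distQuantile N F μ t := by
  have h := (hRV.isTailLimit hN hC hF hμ).conv_mul hl0 one_pos
    (by simp [hRV.measure_dst_eq hN hC hF hμ one_pos])
  simp only [mul_one] at h
  filter_upwards [h.eventually_const_lt ((one_lt_div hl0).2 hl), eventually_gt_atTop 0,
    hRV.eventually_distQuantile_le hN hC hF hμ (lt_add_one _)] with t ht ht0 hq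
  exact le_distQuantile hF ht0 ht hq.1

/-- Both choices of the normalizing function are eventually positive and give, up to a constant
`κ`, the same limit of the exceedance measures; `κ = 1` for `b` and `κ = ν {d(x, F) > 1}` for the
quantile function. -/
theorem IsRegularlyVarying.exists_tendsto_integral {a : ℝ → ℝ}
    (ha : a = b ∨ a = distQuantile N F μ) :
    (∀ᶠ t in atTop, 0 < a t) ∧ ∃ c, 0 < c ∧ ∀ f : unitSphere N C F →ᵇ ℝ,
      Tendsto (fun t => t * ∫ x, f x ∂exceedanceMeasure hC hF p μ (a t)) atTop
        (𝓝 (c * ∫ x, f x ∂spectralMeasure N C F ν)) := by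
  have hpos := hRV.measureReal_pos hN hC hF hμ one_pos
  obtain ⟨κ, hκ, hlow, hupp⟩ : ∃ κ, 0 < κ ∧
      (∀ l, 0 < l → l < κ → ∀ᶠ t in atTop, b (l * t) ≤ a t) ∧
      (∀ l, κ < l → ∀ᶠ t in atTop, a t ≤ b (l * t)) := by
    rcases ha with rfl | rfl
    · refine ⟨1, one_pos, fun l hl0 hl => ?_, fun l hl => ?_⟩
      · filter_upwards [eventually_gt_atTop 0] with t ht
        exact hRV.monotone (mul_pos hl0 ht) ht (mul_le_of_le_one_left ht.le hl.le)
      · filter_upwards [eventually_gt_atTop 0] with t ht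
        exact hRV.monotone ht (mul_pos (one_pos.trans hl) ht) (le_mul_of_one_le_left ht.le hl.le)
    · exact ⟨_, hpos, fun l hl0 hl => hRV.eventually_le_distQuantile hN hC hF hμ hl0 hl,
        fun l hl => (hRV.eventually_distQuantile_le hN hC hF hμ hl).mono fun t ht => ht.2⟩
  refine ⟨?_, ν.real {x | 1 < dst N F x} / κ, by positivity, fun f => ?_⟩
  · filter_upwards [hlow _ (half_pos hκ) (half_lt_self hκ),
      (hRV.tendsto.comp (tendsto_id.const_mul_atTop (half_pos hκ))).eventually_gt_atTop 0]
      with t h1 h2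
    exact lt_of_lt_of_le h2 h1
  · have h := hRV.tendsto_integral_exceedanceMeasure_of_squeeze hN hC hF p hμ hκ hlow hupp f
    rwa [hRV.integral_radialLimit hN hC hF p hμ, mul_div_right_comm] at h

end

/-! ### A weak law of large numbers for triangular arrays -/

/-- Weak law of large numbers, by Chebyshev's inequality, for the sums of `φ n (Z i)` over `i < n`,
normalized by `k n → ∞`: the variance of the normalized sum is at most
`(n / k n) E[φ n (Z 0) ^ 2] / k n`. -/
theorem tendsto_measure_le_abs_sum_sub {Ω E : Type*} [MeasurableSpace Ω] [MeasurableSpace E]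
    {P : Measure Ω} [IsProbabilityMeasure P] {Z : ℕ → Ω → E} (hZ_meas : ∀ i, Measurable (Z i))
    (hZ_indep : iIndepFun Z P) (hZ_ident : ∀ i, IdentDistrib (Z i) (Z 0) P P)
    {k : ℕ → ℕ} (hk : Tendsto k atTop atTop) {φ : ℕ → E → ℝ} (hφ : ∀ n, Measurable (φ n))
    {M : ℝ} (hM : ∀ n x, |φ n x| ≤ M) {m v : ℝ}
    (hmean : Tendsto (fun n : ℕ => (n : ℝ) / k n * ∫ ω, φ n (Z 0 ω) ∂P) atTop (𝓝 m))
    (hvar : Tendsto (fun n : ℕ => (n : ℝ) / k n * ∫ ω, φ n (Z 0 ω) ^ 2 ∂P) atTop (𝓝 v))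
    {ε : ℝ} (hε : 0 < ε) :
    Tendsto (fun n => P {ω | ε ≤ |(∑ i ∈ Finset.range n, φ n (Z i ω)) / k n - m|}) atTop
      (𝓝 0) := by
  have hkR : Tendsto (fun n => (k n : ℝ)) atTop atTop :=
    tendsto_natCast_atTop_atTop.comp hk
  have hmeas : ∀ n i, Measurable fun ω => φ n (Z i ω) := fun n i => (hφ n).comp (hZ_meas i)
  have hLp : ∀ n i, MemLp (fun ω => φ n (Z i ω)) 2 P := fun n i =>
    MemLp.of_bound (hmeas n i).aestronglyMeasurable M (Eventually.of_forall fun ω => hM n _)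
  have hid : ∀ n i, IdentDistrib (fun ω => φ n (Z i ω)) (fun ω => φ n (Z 0 ω)) P P :=
    fun n i => (hZ_ident i).comp (hφ n)
  have hbound : Tendsto (fun n : ℕ => ENNReal.ofReal
      (4 / ε ^ 2 * ((n : ℝ) / k n * ∫ ω, φ n (Z 0 ω) ^ 2 ∂P) * (k n : ℝ)⁻¹)) atTop (𝓝 0) := by
    have := ENNReal.tendsto_ofReal ((hvar.const_mul (4 / ε ^ 2)).mul hkR.inv_tendsto_atTop)
    simpa using this
  refine tendsto_of_tendsto_of_tendsto_of_le_of_le' tendsto_const_nhds hbound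
    (Eventually.of_forall fun _ => zero_le) ?_
  filter_upwards [hkR.eventually_gt_atTop 0,
    (Metric.tendsto_nhds.1 hmean) (ε / 2) (half_pos hε)] with n hkn hn
  set S : Ω → ℝ := ∑ i ∈ Finset.range n, fun ω => φ n (Z i ω) with hS
  have hSapp : ∀ ω, S ω = ∑ i ∈ Finset.range n, φ n (Z i ω) := fun ω => by simp [hS]
  have hSLp : MemLp S 2 P := memLp_finsetSum' _ fun i _ => hLp n i
  have hES : P[S] = n * ∫ ω, φ n (Z 0 ω) ∂P := by
    simp_rw [hSapp]
    rw [integral_finsetSum _ fun i _ => (hLp n i).integrable one_le_two,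
      Finset.sum_congr rfl fun i _ => (hid n i).integral_eq]
    simp
  have hVS : variance S P ≤ n * ∫ ω, φ n (Z 0 ω) ^ 2 ∂P := by
    rw [hS, IndepFun.variance_sum (fun i _ => hLp n i) fun i _ j _ hij =>
      (hZ_indep.indepFun hij).comp (hφ n) (hφ n),
      Finset.sum_congr rfl fun i _ => (hid n i).variance_eq, Finset.sum_const, Finset.card_range,
      nsmul_eq_mul]
    gcongr
    exact variance_le_expectation_sq (hmeas n 0).aestronglyMeasurable
  have hsub : {ω | ε ≤ |(∑ i ∈ Finset.range n, φ n (Z i ω)) / k n - m|} ⊆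
      {ω | ε / 2 * k n ≤ |S ω - P[S]|} := by
    intro ω hω
    rw [mem_ofPred_eq, ← hSapp] at hω
    rw [Real.dist_eq] at hn
    have h1 : ε / 2 ≤ |S ω / k n - n / k n * ∫ ω, φ n (Z 0 ω) ∂P| := by
      have := abs_sub_le (S ω / k n) (n / k n * ∫ ω, φ n (Z 0 ω) ∂P) m
      linarith
    have h2 : S ω - P[S] = (S ω / k n - n / k n * ∫ ω, φ n (Z 0 ω) ∂P) * k n := by
      rw [hES]
      field_simp
    rw [mem_ofPred_eq, h2, abs_mul, abs_of_pos hkn]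
    exact mul_le_mul_of_nonneg_right h1 hkn.le
  refine (measure_mono hsub).trans ((meas_ge_le_variance_div_sq hSLp (by positivity)).trans ?_)
  refine ENNReal.ofReal_le_ofReal ((div_le_div_of_nonneg_right hVS (sq_nonneg _)).trans_eq ?_)
  field_simp
  ring

/-! ### Random probability measures -/

section RandomMeasure

variable {Ω X : Type*} [MeasurableSpace Ω] [TopologicalSpace X] [MeasurableSpace X]
  [OpensMeasurableSpace X]

/-- Random probability measures converge in probability to a constant `S`, in the sense of
neighbourhoods of `S`, if the integrals of bounded continuous functions do so. The sets `U` with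
`P[S_n ∉ U] → 0` form a filter on the space of probability measures; the hypothesis says that
integrals converge along this filter, hence that it is finer than `𝓝 S`. -/
theorem tendsto_measure_notMem_nhds {P : Measure Ω} {Sn : ℕ → Ω → ProbabilityMeasure X}
    {S : ProbabilityMeasure X}
    (h : ∀ f : X →ᵇ ℝ, ∀ ε, 0 < ε →
      Tendsto (fun n => P {ω | ε ≤ |∫ x, f x ∂(Sn n ω : Measure X) - ∫ x, f x ∂(S : Measure X)|})
        atTop (𝓝 0))
    {U : Set (ProbabilityMeasure X)} (hU : U ∈ 𝓝 S) :
    Tendsto (fun n => P {ω | Sn n ω ∉ U}) atTop (𝓝 0) := by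
  let 𝓕 : Filter (ProbabilityMeasure X) :=
    { sets := {U | Tendsto (fun n => P {ω | Sn n ω ∉ U}) atTop (𝓝 0)}
      univ_sets := by simp
      sets_of_superset := fun {U V} hU hUV =>
        tendsto_of_tendsto_of_tendsto_of_le_of_le tendsto_const_nhds hU (fun _ => zero_le)
          fun n => measure_mono fun ω hω hωU => hω (hUV hωU)
      inter_sets := fun {U V} hU hV => by
        have hadd := Tendsto.add (show Tendsto _ _ _ from hU) (show Tendsto _ _ _ from hV)
        rw [add_zero] at hadd
        refine tendsto_of_tendsto_of_tendsto_of_le_of_le tendsto_const_nhds hadd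
          (fun _ => zero_le) fun n => (measure_mono fun ω hω => ?_).trans (measure_union_le _ _)
        by_contra hcon
        simp only [mem_union, mem_ofPred_eq, not_or, not_not] at hcon
        exact hω ⟨hcon.1, hcon.2⟩ }
  have hle : Tendsto id 𝓕 (𝓝 S) := by
    rw [ProbabilityMeasure.tendsto_iff_forall_integral_tendsto]
    intro f
    rw [Metric.tendsto_nhds]
    intro ε hε
    change Tendsto _ _ _
    refine (h f ε hε).congr fun n => ?_
    simp only [mem_ofPred_eq, Real.dist_eq, not_lt, id]
  exact hle hU

theorem tendstoInLaw_of_tendsto_integral {P : Measure Ω} [IsProbabilityMeasure P]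
    {Sn : ℕ → Ω → ProbabilityMeasure X} {S : ProbabilityMeasure X}
    (hm : ∀ n, @Measurable _ _ _ (borel _) (Sn n))
    (h : ∀ f : X →ᵇ ℝ, ∀ ε, 0 < ε →
      Tendsto (fun n => P {ω | ε ≤ |∫ x, f x ∂(Sn n ω : Measure X) - ∫ x, f x ∂(S : Measure X)|})
        atTop (𝓝 0)) :
    TendstoInLaw P Sn S := by
  let _ : MeasurableSpace (ProbabilityMeasure X) := borel _
  have : OpensMeasurableSpace (ProbabilityMeasure X) := ⟨le_rfl⟩
  refine ⟨fun n => (hm n).aemeasurable, measurable_const.aemeasurable, ?_⟩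
  refine tendsto_of_forall_isOpen_le_liminf' fun G hG => ?_
  simp only [ProbabilityMeasure.coe_mk]
  by_cases hSG : S ∈ G
  · have h0 := tendsto_measure_notMem_nhds h (hG.mem_nhds hSG)
    have h1 : Tendsto (fun n => P.map (Sn n) G) atTop (𝓝 1) := by
      have hsub : Tendsto (fun n => 1 - P {ω | Sn n ω ∉ G}) atTop (𝓝 (1 - 0)) :=
        ENNReal.Tendsto.sub tendsto_const_nhds h0 (Or.inl ENNReal.one_ne_top)
      rw [tsub_zero] at hsub
      refine hsub.congr fun n => ?_
      have hcompl := prob_compl_eq_one_sub (μ := P) ((hm n) hG.measurableSet.compl)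
      rw [Measure.map_apply (hm n) hG.measurableSet]
      rw [preimage_compl, compl_compl] at hcompl
      exact hcompl.symm
    rw [h1.liminf_eq]
    exact prob_le_one
  · rw [Measure.map_apply measurable_const hG.measurableSet]
    simp [hSG]

/-- The empirical distribution of the points `x i`, `i ∈ I`. -/
def empiricalPM (I : Finset ℕ) (hI : I.Nonempty) (x : ℕ → X) : ProbabilityMeasure X :=
  ⟨(I.card : ℝ≥0∞)⁻¹ • ∑ i ∈ I, Measure.dirac (x i), ⟨by
    rw [Measure.smul_apply, Measure.finsetSum_apply]
    simpa using ENNReal.inv_mul_cancel (by simpa using hI.ne_empty) (by simp)⟩⟩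

theorem integral_empiricalPM (I : Finset ℕ) (hI : I.Nonempty) (x : ℕ → X) (f : X →ᵇ ℝ) :
    ∫ y, f y ∂(empiricalPM I hI x : Measure X) = (I.card : ℝ)⁻¹ * ∑ i ∈ I, f (x i) := by
  rw [empiricalPM, ProbabilityMeasure.coe_mk, integral_smul_measure,
    integral_finsetSum_measure fun i _ => f.integrable _]
  simp [integral_dirac' _ _ f.continuous.stronglyMeasurable]

theorem continuous_empiricalPM (I : Finset ℕ) (hI : I.Nonempty) :
    Continuous (empiricalPM (X := X) I hI) := by
  rw [ProbabilityMeasure.continuous_iff_forall_continuous_integral]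
  intro f
  simp_rw [integral_empiricalPM]
  exact continuous_const.mul
    (continuous_finsetSum _ fun i _ => f.continuous.comp (continuous_apply i))

end RandomMeasure

/-! ### The empirical spectral measure -/

section Empirical

variable {d : ℕ} {N : Seminorm ℝ (Fin d → ℝ)} {C F : Set (Fin d → ℝ)}
  (hC : IsClosedCone C) (hF : IsClosedCone F) (p : unitSphere N C F)

theorem dst_pos_of_mem_exceedances {r : ℝ} {n : ℕ} {z : ℕ → Fin d → ℝ} {i : ℕ}
    (hi : i ∈ exceedances N F r n z) : 0 < dst N F (z i) := by
  have hi' : 1 < dst N F (z i) / r := (Finset.mem_filter.1 hi).2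
  refine lt_of_le_of_ne (dst_nonneg _) fun h => ?_
  rw [← h, zero_div] at hi'
  exact absurd hi' (by norm_num)

open Classical in
/-- The empirical spectral measure is the empirical distribution of the projections of the
exceedances, if there are any. -/
theorem empiricalSpectralPM_eq (Q : ProbabilityMeasure (unitSphere N C F)) (r : ℝ) (n : ℕ)
    {z : ℕ → Fin d → ℝ} (hz : ∀ i, z i ∈ C) :
    empiricalSpectralPM N C F Q r n z =
      if h : (exceedances N F r n z).Nonempty then
        empiricalPM (exceedances N F r n z) h fun i => radial hC hF p (z i) else Q := by
  by_cases h : (exceedances N F r n z).Nonempty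
  · refine ((dif_pos (isProbabilityMeasure_empiricalSpectral hC hF hz h)).trans
      (Subtype.ext ?_)).trans (dif_pos h).symm
    change empiricalSpectral N C F r n z = _
    rw [empiricalSpectral, empiricalPM]
    refine congrArg _ (Finset.sum_congr rfl fun i hi => ?_)
    rw [← coe_radial hC hF p (hz i) (dst_pos_of_mem_exceedances hi),
      ← Measure.map_dirac' measurable_subtype_coe,
      (MeasurableEmbedding.subtype_coe (measurableSet_unitSphere hC hF)).comap_map]
  · have hnot : ¬ IsProbabilityMeasure (empiricalSpectral N C F r n z) := by
      intro hp
      have h1 : empiricalSpectral N C F r n z univ = 1 := measure_univ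
      rw [empiricalSpectral, Finset.not_nonempty_iff_eq_empty.1 h] at h1
      simp at h1
    rw [dif_neg h]
    exact dif_neg hnot

/-- The empirical spectral measure is a random element of `P(∂ℵ)`: on the event that a given set
of indices is the set of exceedances, it is a continuous function of the projected points. -/
theorem measurable_empiricalSpectralPM {Ω : Type*} [MeasurableSpace Ω] {Z : ℕ → Ω → Fin d → ℝ}
    (hC : IsClosedCone C) (hF : IsClosedCone F)
    (hZ_meas : ∀ i, Measurable (Z i)) (hZ_mem : ∀ i ω, Z i ω ∈ C)
    (Q : ProbabilityMeasure (unitSphere N C F)) (r : ℝ) (n : ℕ) :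
    @Measurable _ _ _ (borel _)
      (fun ω => empiricalSpectralPM N C F Q r n fun i => Z i ω) := by
  classical
  let _ : MeasurableSpace (ProbabilityMeasure (unitSphere N C F)) := borel _
  have : BorelSpace (ProbabilityMeasure (unitSphere N C F)) := ⟨rfl⟩
  let _ : MeasurableSpace (Finset ℕ) := ⊤
  obtain ⟨p⟩ : Nonempty (unitSphere N C F) := Q.nonempty
  let Φ : Finset ℕ × (ℕ → unitSphere N C F) → ProbabilityMeasure (unitSphere N C F) := fun q =>
    if h : q.1.Nonempty then empiricalPM q.1 h q.2 else Q
  have hΦ : Measurable Φ := by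
    refine measurable_from_prod_countable_right fun I => ?_
    by_cases hI : I.Nonempty
    · simpa only [Φ, dif_pos hI] using (continuous_empiricalPM I hI).measurable
    · simp only [Φ, dif_neg hI]
      exact measurable_const
  have hexc : Measurable fun ω => exceedances N F r n fun i => Z i ω := by
    refine measurable_to_countable' fun I => ?_
    have hset : (fun ω => exceedances N F r n fun i => Z i ω) ⁻¹' {I} =
        ⋂ i, {ω | i ∈ Finset.range n ∧ 1 < dst N F (Z i ω) / r ↔ i ∈ I} := by
      ext ω
      simp [exceedances, Finset.ext_iff]
    rw [hset]
    refine MeasurableSet.iInter fun i => ?_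
    have h1 : MeasurableSet {ω | 1 < dst N F (Z i ω) / r} :=
      measurableSet_lt measurable_const
        (((continuous_dst hF).measurable.comp (hZ_meas i)).div_const r)
    exact ((MeasurableSet.const _).inter h1).iff (MeasurableSet.const _)
  have hrad : Measurable fun ω i => radial hC hF p (Z i ω) :=
    measurable_pi_lambda _ fun i => (measurable_radial hC hF p).comp (hZ_meas i)
  have heq : (fun ω => empiricalSpectralPM N C F Q r n fun i => Z i ω) =
      fun ω => Φ (exceedances N F r n fun i => Z i ω, fun i => radial hC hF p (Z i ω)) :=
    funext fun ω => empiricalSpectralPM_eq hC hF p Q r n fun i => hZ_mem i ω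
  rw [heq]
  exact hΦ.comp (hexc.prodMk hrad)

/-- The function whose sum over the sample is the sum of `f` over the projected exceedances. -/
def exceedanceFun (f : unitSphere N C F →ᵇ ℝ) (r : ℝ) : (Fin d → ℝ) → ℝ :=
  {z | r < dst N F z}.indicator fun z => f (radial hC hF p z)

theorem measurable_exceedanceFun (f : unitSphere N C F →ᵇ ℝ) (r : ℝ) :
    Measurable (exceedanceFun hC hF p f r) :=
  (f.continuous.measurable.comp (measurable_radial hC hF p)).indicator
    (measurableSet_lt measurable_const (continuous_dst hF).measurable)

theorem abs_exceedanceFun_le (f : unitSphere N C F →ᵇ ℝ) (r : ℝ) (z : Fin d → ℝ) :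
    |exceedanceFun hC hF p f r z| ≤ ‖f‖ :=
  (norm_indicator_le_norm_self (fun z => f (radial hC hF p z)) z).trans (f.norm_coe_le_norm _)

theorem exceedanceFun_sq (f : unitSphere N C F →ᵇ ℝ) (r : ℝ) (z : Fin d → ℝ) :
    exceedanceFun hC hF p f r z ^ 2 = exceedanceFun hC hF p (f * f) r z := by
  by_cases hz : r < dst N F z
  · simp [exceedanceFun, hz, sq]
  · simp [exceedanceFun, hz]

theorem sum_exceedanceFun (f : unitSphere N C F →ᵇ ℝ) {r : ℝ} (hr : 0 < r) (n : ℕ)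
    (z : ℕ → Fin d → ℝ) :
    ∑ i ∈ Finset.range n, exceedanceFun hC hF p f r (z i) =
      ∑ i ∈ exceedances N F r n z, f (radial hC hF p (z i)) := by
  rw [exceedances, Finset.sum_filter]
  refine Finset.sum_congr rfl fun i _ => ?_
  simp [exceedanceFun, indicator_apply, one_lt_div hr]

end Empirical

/-! ### Consistency of the empirical spectral measure -/

section Consistency

variable {d : ℕ} {N : Seminorm ℝ (Fin d → ℝ)} {C F : Set (Fin d → ℝ)}
  (hC : IsClosedCone C) (hF : IsClosedCone F) (p : unitSphere N C F)
  {Ω : Type*} [MeasurableSpace Ω] {P : Measure Ω} {Z : ℕ → Ω → Fin d → ℝ} {k : ℕ → ℕ} {r : ℕ → ℝ} {c : ℝ}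
  {S : ProbabilityMeasure (unitSphere N C F)}

/-- The law of large numbers for the sums of `f` over the projected exceedances of the
levels `r n`. -/
theorem tendsto_measure_le_abs_sum_exceedanceFun_sub [IsProbabilityMeasure P]
    (hZ_meas : ∀ i, Measurable (Z i))
    (hZ_indep : iIndepFun Z P) (hZ_ident : ∀ i, IdentDistrib (Z i) (Z 0) P P)
    (hk : Tendsto k atTop atTop)
    (hint : ∀ f : unitSphere N C F →ᵇ ℝ, Tendsto (fun n : ℕ => (n : ℝ) / k n *
      ∫ x, f x ∂exceedanceMeasure hC hF p (P.map (Z 0)) (r n)) atTop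
        (𝓝 (c * ∫ x, f x ∂(S : Measure (unitSphere N C F)))))
    (f : unitSphere N C F →ᵇ ℝ) {ε : ℝ} (hε : 0 < ε) :
    Tendsto (fun n => P {ω | ε ≤
      |(∑ i ∈ Finset.range n, exceedanceFun hC hF p f (r n) (Z i ω)) / k n -
        c * ∫ x, f x ∂(S : Measure (unitSphere N C F))|}) atTop (𝓝 0) := by
  have hE : ∀ (g : unitSphere N C F →ᵇ ℝ) n,
      ∫ x, g x ∂exceedanceMeasure hC hF p (P.map (Z 0)) (r n) =
        ∫ ω, exceedanceFun hC hF p g (r n) (Z 0 ω) ∂P := by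
    intro g n
    rw [integral_exceedanceMeasure, ← integral_map (hZ_meas 0).aemeasurable
      (measurable_exceedanceFun hC hF p g (r n)).aestronglyMeasurable]
    rfl
  simp_rw [hE] at hint
  refine tendsto_measure_le_abs_sum_sub hZ_meas hZ_indep hZ_ident hk
    (fun n => measurable_exceedanceFun hC hF p f (r n))
    (fun n => abs_exceedanceFun_le hC hF p f (r n)) (hint f)
    (v := c * ∫ x, (f * f) x ∂(S : Measure (unitSphere N C F))) ?_ hε
  simp_rw [exceedanceFun_sq]
  exact hint (f * f)

variable (hc : 0 < c) (hr : ∀ᶠ n in atTop, 0 < r n)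
  (hlln : ∀ (f : unitSphere N C F →ᵇ ℝ) (ε : ℝ), 0 < ε →
    Tendsto (fun n => P {ω | ε ≤
      |(∑ i ∈ Finset.range n, exceedanceFun hC hF p f (r n) (Z i ω)) / k n -
        c * ∫ x, f x ∂(S : Measure (unitSphere N C F))|}) atTop (𝓝 0))

include hc hr hlln

theorem tendsto_measure_exceedances_eq_empty :
    Tendsto (fun n => P {ω | exceedances N F (r n) n (fun i => Z i ω) = ∅}) atTop (𝓝 0) := by
  refine tendsto_of_tendsto_of_tendsto_of_le_of_le' tendsto_const_nhds
    (hlln (BoundedContinuousFunction.const _ 1) c hc) (Eventually.of_forall fun _ => zero_le) ?_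
  filter_upwards [hr] with n hn
  refine measure_mono fun ω hω => ?_
  rw [mem_ofPred_eq] at hω
  rw [mem_ofPred_eq, sum_exceedanceFun hC hF p _ hn n fun i => Z i ω, hω]
  simp [le_abs_self]

/-- With `h = f - ∫ f dS`, the difference `∫ f dS_n - ∫ f dS` is the ratio of the sums of `h` and
of `1` over the exceedances. Divided by `k n` these converge to `0` and to `c > 0`. -/
theorem tendsto_measure_le_abs_integral_sub (hZ_mem : ∀ i ω, Z i ω ∈ C)
    (Q : ProbabilityMeasure (unitSphere N C F)) (f : unitSphere N C F →ᵇ ℝ) {ε : ℝ}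
    (hε : 0 < ε) :
    Tendsto (fun n => P {ω | ε ≤
      |∫ x, f x ∂(empiricalSpectralPM N C F Q (r n) n (fun i => Z i ω) :
        Measure (unitSphere N C F)) - ∫ x, f x ∂(S : Measure (unitSphere N C F))|})
      atTop (𝓝 0) := by
  set s := ∫ x, f x ∂(S : Measure (unitSphere N C F)) with hs
  let one : unitSphere N C F →ᵇ ℝ := BoundedContinuousFunction.const _ 1
  let h : unitSphere N C F →ᵇ ℝ := f - BoundedContinuousFunction.const _ s
  have hone : ∫ x, one x ∂(S : Measure (unitSphere N C F)) = 1 := by simp [one]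
  have hh : ∫ x, h x ∂(S : Measure (unitSphere N C F)) = 0 := by
    have hsub := integral_sub (f.integrable (S : Measure (unitSphere N C F)))
      (integrable_const s)
    rw [integral_const, probReal_univ, one_smul, ← hs, sub_self] at hsub
    exact hsub
  have h1 := hlln one (c / 2) (half_pos hc)
  have h2 := hlln h (ε * (c / 2)) (by positivity)
  rw [hone, mul_one] at h1
  rw [hh, mul_zero] at h2
  have h12 := h1.add h2
  rw [add_zero] at h12
  refine tendsto_of_tendsto_of_tendsto_of_le_of_le' tendsto_const_nhds h12
    (Eventually.of_forall fun _ => zero_le) ?_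
  filter_upwards [hr] with n hn
  refine (measure_mono fun ω hω => ?_).trans (measure_union_le _ _)
  by_contra hcon
  simp only [mem_union, mem_ofPred_eq, not_or, not_le, sub_zero] at hcon
  obtain ⟨hcon1, hcon2⟩ := hcon
  rw [sum_exceedanceFun hC hF p _ hn n fun i => Z i ω] at hcon1 hcon2
  set I := exceedances N F (r n) n fun i => Z i ω with hI
  have hcard : ∑ i ∈ I, one (radial hC hF p (Z i ω)) = I.card := by simp [one]
  rw [hcard] at hcon1
  have hlarge : c / 2 < (I.card : ℝ) / k n := by
    have := (abs_lt.1 hcon1).1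
    linarith
  have hpos : 0 < (I.card : ℝ) / k n := (half_pos hc).trans hlarge
  have hne : I.Nonempty := by
    rw [Finset.nonempty_iff_ne_empty]
    intro hempty
    simp [hempty] at hpos
  have hcard0 : (I.card : ℝ) ≠ 0 := by
    rw [Nat.cast_ne_zero]
    exact hne.card_ne_zero
  have hratio : ∫ x, f x ∂(empiricalSpectralPM N C F Q (r n) n (fun i => Z i ω) :
      Measure (unitSphere N C F)) - s =
      ((∑ i ∈ I, h (radial hC hF p (Z i ω))) / k n) / ((I.card : ℝ) / k n) := by
    have hk0 : (k n : ℝ) ≠ 0 := fun h0 => by simp [h0] at hpos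
    have hsum : ∑ i ∈ I, h (radial hC hF p (Z i ω)) =
        ∑ i ∈ I, f (radial hC hF p (Z i ω)) - I.card * s := by
      simp [h, Finset.sum_sub_distrib]
    rw [empiricalSpectralPM_eq hC hF p Q (r n) n fun i => hZ_mem i ω, dif_pos hne,
      integral_empiricalPM, hsum, ← hI]
    field_simp
  rw [mem_ofPred_eq, hratio, abs_div, abs_of_pos hpos, le_div_iff₀ hpos] at hω
  have := mul_lt_mul_of_pos_left hlarge hε
  linarith

end Consistency

end ConeRV

end

theorem proposition6p1 {d : ℕ} (N : Seminorm ℝ (Fin d → ℝ)) (hN : ∀ x, N x = 0 → x = 0)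
    (C F : Set (Fin d → ℝ)) (hC : ConeRV.IsClosedCone C) (hF : ConeRV.IsClosedCone F)
    (hFC : F ⊆ C) (hC_nonneg : ∀ x ∈ C, ∀ j, 0 ≤ x j)
    {Ω : Type*} [MeasurableSpace Ω] (P : Measure Ω) [IsProbabilityMeasure P]
    (Z : ℕ → Ω → Fin d → ℝ) (hZ_meas : ∀ i, Measurable (Z i)) (hZ_mem : ∀ i ω, Z i ω ∈ C)
    (hZ_indep : iIndepFun Z P) (hZ_ident : ∀ i, IdentDistrib (Z i) (Z 0) P P)
    (b : ℝ → ℝ) (ν : Measure ↥(C \ F))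
    (hRV : ConeRV.IsRegularlyVarying N C F (P.map (Z 0)) b ν)
    (k : ℕ → ℕ) (hk : Tendsto k atTop atTop)
    (hnk : Tendsto (fun n : ℕ => (n : ℝ) / (k n : ℝ)) atTop atTop) :
    ∃ hS : IsProbabilityMeasure (ConeRV.spectralMeasure N C F ν),
      ∀ a : ℝ → ℝ, (a = b ∨ a = ConeRV.distQuantile N F (P.map (Z 0))) →
        Tendsto (fun n : ℕ =>
          P {ω | ConeRV.exceedances N F (a (n / k n)) n (fun i => Z i ω) = ∅}) atTop (𝓝 0) ∧
        ∀ Q : ProbabilityMeasure ↥(ConeRV.unitSphere N C F),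
          ConeRV.TendstoInLaw P
            (fun n ω => ConeRV.empiricalSpectralPM N C F Q (a (n / k n)) n (fun i => Z i ω))
            ⟨ConeRV.spectralMeasure N C F ν, hS⟩ := by
  have : IsProbabilityMeasure (P.map (Z 0)) :=
    Measure.isProbabilityMeasure_map (hZ_meas 0).aemeasurable
  have hμ : ∀ᵐ z ∂P.map (Z 0), z ∈ C :=
    (ae_map_iff (p := (· ∈ C)) (hZ_meas 0).aemeasurable hC.isClosed.measurableSet).2
      (Eventually.of_forall fun ω => hZ_mem 0 ω)
  refine ⟨hRV.isProbabilityMeasure_spectralMeasure hN hC hF hμ, fun a ha => ?_⟩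
  obtain ⟨p⟩ := hRV.nonempty_unitSphere hN hC hF
  obtain ⟨hpos, c, hc, hint⟩ := hRV.exists_tendsto_integral hN hC hF p hμ ha
  have hr : ∀ᶠ n : ℕ in atTop, 0 < a (n / k n) := hnk.eventually hpos
  have hlln := fun f ε hε => ConeRV.tendsto_measure_le_abs_sum_exceedanceFun_sub hC hF p
    (S := ⟨_, hRV.isProbabilityMeasure_spectralMeasure hN hC hF hμ⟩) (r := fun n => a (n / k n))
    hZ_meas hZ_indep hZ_ident hk (fun f => (hint f).comp hnk) f (ε := ε) hε
  refine ⟨ConeRV.tendsto_measure_exceedances_eq_empty hC hF p hc hr hlln, fun Q => ?_⟩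
  exact ConeRV.tendstoInLaw_of_tendsto_integral
    (fun n => ConeRV.measurable_empiricalSpectralPM hC hF hZ_meas hZ_mem Q _ n)
    fun f ε hε => ConeRV.tendsto_measure_le_abs_integral_sub hC hF p hc hr hlln hZ_mem Q f hε
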